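/- **Setting.** All algebras are complex and unital, and all homomorphisms are unital. A *graded-differential \*-algebra* is an $\mathbb N$-graded algebra with a differential $d$ of degree $1$ satisfying $d(xy)=d(x)y+(-1)^{\partial x}x\,d(y)$, and an antilinear degree-preserving involution with $(xy)^*=(-1)^{\partial x\,\partial y}y^*x^*$ and $d(x^*)=d(x)^*$. $\widehat\otimes$ is the graded tensor product, with differential $d\otimes\mathrm{id}+(-1)^{\partial}\otimes d$ and involution $*\otimes *$. Let $\mathcal A$ be the Hopf \*-algebra of polynomial functions on a compact matrix quantum group $G$ (generated by the matrix entries of a finite-dimensional unitary corepresentation), with coproduct $\phi$. Let $\Gamma$ be a bicovariant first-order \*-calculus over $G$, $\Gamma_{inv}\subseteq\Gamma$ the space of left-invariant elements, and $\varpi:\Gamma_{inv}\to\Gamma_{inv}\otimes\mathcal A$ the restriction of the right coaction of $\Gamma$. Let $\Gamma^\star$ be either the universal differential envelope $\Gamma^\wedge$ of $\Gamma$ or, more generally, any quotient of $\Gamma^\wedge$ by a graded-differential \*-ideal which is trivial in degrees $0$ and $1$ (for example the braided exterior algebra $\Gamma^\vee$). Let $P=(\mathcal B,i,F)$ be a quantum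 principal $G$-bundle over a quantum space $M$ represented by a \*-algebra $\mathcal V$: $F:\mathcal B\to\mathcal B\otimes\mathcal A$ is a coaction by \*-homomorphisms, $i:\mathcal V\to\mathcal B$ is an injective \*-homomorphism onto $\{b: F(b)=b\otimes 1\}$, and each $1\otimes a$ is a sum of elements $(q\otimes 1)F(b)$. Let $\Omega(P)$ be a calculus on $P$: a graded-differential \*-algebra with $\Omega^0(P)=\mathcal B$, generated by $\mathcal B$ as a differential algebra, such that $F$ extends to a homomorphism $\widehat F:\Omega(P)\to\Omega(P)\mathbin{\widehat\otimes}\Gamma^\star$ of graded-differential \*-algebras. Put $\Omega(M)=\{w\in\Omega(P):\widehat F(w)=w\otimes1\}$ and let $H(M)$ be its cohomology algebra. A *connection* is a hermitian linear map $\omega:\Gamma_{inv}\to\Omega^1(P)$ with $$\widehat F\omega(\vartheta)=(\omega\otimes\mathrm{id})\varpi(\vartheta)+1\otimes\vartheta,\qquad \vartheta\in\Gamma_{inv}.$$ Let $\Omega$ be the universal differential envelope of the tensor algebra $\Gamma_{inv}^{\otimes}$, that is, the differential algebra generated by $\Gamma_{inv}$ (in degree $1$) with the only relation $d(1)=0$,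 with the \*-structure extending that of $\Gamma_{inv}$. Let $\widetilde\varpi:\Omega\to\Omega\mathbin{\widehat\otimes}\Gamma^\star$ be the graded-differential homomorphism with $\widetilde\varpi(\vartheta)=\varpi(\vartheta)+1\otimes\vartheta$, let $\daleth=\{w\in\Omega:\widetilde\varpi(w)=w\otimes1\}$, a graded-differential subalgebra, and let $H(\daleth)$ be its cohomology algebra. **Proposition.** (i) For each connection $\omega$ there exists a unique homomorphism $\widehat\omega:\Omega\to\Omega(P)$ of differential algebras with $\widehat\omega(\vartheta)=\omega(\vartheta)$ for each $\vartheta\in\Gamma_{inv}$. It preserves the grading, it is hermitian, and $\widehat F\,\widehat\omega=(\widehat\omega\otimes\mathrm{id})\widetilde\varpi$. In particular $\widehat\omega(\daleth)\subseteq\Omega(M)$. (ii) The induced homomorphism $W:H(\daleth)\to H(M)$ of cohomology algebras does not depend on $\omega$. More precisely, for any two connections $\omega,\tau$ there is a unique linear map $L:\Omega\to\Omega(P)$ with $$L(1)=0,\quad L(\vartheta)=0,\quad L(d\vartheta)=\omega(\vartheta)-\tau(\vartheta),\quad L(wu)=L(w)\widehat\tau(u)+(-1)^{\partial w}\widehat\omega(w)L(u)$$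 for $\vartheta\in\Gamma_{inv}$, homogeneous $w\in\Omega$ and $u\in\Omega$; it satisfies $$\widehat\omega-\widehat\tau=Ld+dL,\qquad \widehat F L=(L\otimes\mathrm{id})\widetilde\varpi,\qquad L(\daleth)\subseteq\Omega(M).$$ -/

import Mathlib

open scoped TensorProduct DirectSum

universe u v w

noncomputable section

namespace QPB

/-! ### Graded-differential *-algebras -/

/-- A graded-differential *-algebra over `ℂ`: a unital `ℕ`-graded algebra with a differential `d` of
degree one satisfying the graded Leibniz rule, and an antilinear, degree preserving, graded
antimultiplicative involution `st` commuting with `d`. -/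
structure GDSAlg where
  carrier : Type u
  [ring : Ring carrier]
  [algebra : Algebra ℂ carrier]
  gr : ℕ → Submodule ℂ carrier
  [graded : GradedAlgebra gr]
  d : carrier →ₗ[ℂ] carrier
  st : carrier →ₛₗ[starRingEnd ℂ] carrier
  d_mem : ∀ n, ∀ x ∈ gr n, d x ∈ gr (n + 1)
  d_d : ∀ x, d (d x) = 0
  d_mul : ∀ n, ∀ x ∈ gr n, ∀ y, d (x * y) = d x * y + (-1 : ℂ) ^ n • (x * d y)
  st_mem : ∀ n, ∀ x ∈ gr n, st x ∈ gr n
  st_st : ∀ x, st (st x) = x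
  st_mul : ∀ m n, ∀ x ∈ gr m, ∀ y ∈ gr n, st (x * y) = (-1 : ℂ) ^ (m * n) • (st y * st x)
  st_d : ∀ x, st (d x) = d (st x)

instance : CoeSort GDSAlg.{u} (Type u) := ⟨GDSAlg.carrier⟩
attribute [instance] GDSAlg.ring GDSAlg.algebra GDSAlg.graded

section Grading

variable {A : Type*} [Ring A] [Algebra ℂ A] (gr : ℕ → Submodule ℂ A) [GradedAlgebra gr]

/-- The linear operator multiplying elements of degree `n` by the scalar `f n`. -/
def gradeScale (f : ℕ → ℂ) : A →ₗ[ℂ] A :=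
  DirectSum.toModule ℂ ℕ A (fun n => f n • (gr n).subtype) ∘ₗ
    (DirectSum.decomposeLinearEquiv gr).toLinearMap

theorem gradeScale_apply (f : ℕ → ℂ) {n : ℕ} {x : A} (hx : x ∈ gr n) :
    gradeScale gr f x = f n • x := by
  simp only [gradeScale, LinearMap.comp_apply, LinearEquiv.coe_coe,
    DirectSum.decomposeLinearEquiv_apply]
  rw [DirectSum.decompose_of_mem gr hx, ← DirectSum.lof_eq_of ℂ, DirectSum.toModule_lof]
  simp

/-- To prove a property of all elements, it suffices to treat homogeneous ones. -/
theorem hom_induction {p : A → Prop} (h : ∀ n, ∀ x ∈ gr n, p x)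
    (hadd : ∀ x y, p x → p y → p (x + y)) (x : A) : p x :=
  DirectSum.Decomposition.inductionOn gr (h 0 0 (zero_mem _)) (fun {i} m => h i m m.2) hadd x

theorem proj_of_mem {n : ℕ} {x : A} (hx : x ∈ gr n) (m : ℕ) :
    GradedAlgebra.proj gr m x = if m = n then x else 0 := by
  rw [GradedAlgebra.proj_apply]
  split_ifs with h
  · subst h; exact DirectSum.decompose_of_mem_same gr hx
  · exact DirectSum.decompose_of_mem_ne gr hx (Ne.symm h)

theorem proj_mem (m : ℕ) (x : A) : GradedAlgebra.proj gr m x ∈ gr m := by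
  rw [GradedAlgebra.proj_apply]; exact SetLike.coe_mem _

theorem sum_proj (x : A) : ∃ N, x = ∑ n ∈ Finset.range N, GradedAlgebra.proj gr n x := by
  classical
  refine ⟨((DirectSum.decompose gr x).support.sup id) + 1, ?_⟩
  conv_lhs => rw [← DirectSum.sum_support_decompose gr x]
  refine Finset.sum_subset ?_ ?_
  · intro i hi
    exact Finset.mem_range.2 (Nat.lt_succ_of_le (Finset.le_sup (f := id) hi))
  · intro i _ hi
    simpa using hi

end Grading

namespace GDSAlg

variable (A : GDSAlg.{u}) (B : GDSAlg.{v}) (C : GDSAlg.{w})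

/-- The parity operator `x ↦ (-1)^∂x x`. -/
def parity : A →ₗ[ℂ] A := gradeScale A.gr (fun n => (-1) ^ n)

/-- The projection onto the component of degree `n`. -/
abbrev proj (n : ℕ) : A →ₗ[ℂ] A := GradedAlgebra.proj A.gr n

variable {A} in
theorem parity_apply {n : ℕ} {x : A} (hx : x ∈ A.gr n) : A.parity x = (-1 : ℂ) ^ n • x :=
  gradeScale_apply _ _ hx

theorem leibniz (x y : A) : A.d (x * y) = A.d x * y + A.parity x * A.d y := by
  refine hom_induction A.gr (p := fun x => A.d (x * y) = A.d x * y + A.parity x * A.d y) ?_ ?_ x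
  · intro n x hx
    rw [A.d_mul n x hx, parity_apply hx, smul_mul_assoc]
  · intro x x' h h'
    simp only [add_mul, map_add, h, h']; abel

theorem one_mem : (1 : A) ∈ A.gr 0 := SetLike.GradedOne.one_mem

theorem parity_one : A.parity 1 = 1 := by simp [parity_apply A.one_mem]

theorem d_one : A.d 1 = 0 := by
  have := A.leibniz 1 1
  simpa [parity_one] using this

theorem parity_parity (x : A) : A.parity (A.parity x) = x := by
  refine hom_induction A.gr (p := fun x => A.parity (A.parity x) = x) ?_ ?_ x
  · intro n x hx
    rw [parity_apply hx, map_smul, parity_apply hx, smul_smul, ← mul_pow]; simp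
  · intro x y h h'; simp [h, h']

theorem parity_mul (x y : A) : A.parity (x * y) = A.parity x * A.parity y := by
  refine hom_induction A.gr (p := fun x => A.parity (x * y) = A.parity x * A.parity y) ?_ ?_ x
  · intro n x hx
    refine hom_induction A.gr (p := fun y => A.parity (x * y) = A.parity x * A.parity y) ?_ ?_ y
    · intro m y hy
      rw [parity_apply hx, parity_apply hy, parity_apply (SetLike.GradedMul.mul_mem hx hy),
        smul_mul_smul_comm, pow_add]
    · intro y y' h h'; simp [mul_add, h, h']
  · intro x x' h h'; simp [add_mul, h, h']

theorem d_parity (x : A) : A.d (A.parity x) = - A.parity (A.d x) := by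
  refine hom_induction A.gr (p := fun x => A.d (A.parity x) = - A.parity (A.d x)) ?_ ?_ x
  · intro n x hx
    rw [parity_apply hx, parity_apply (A.d_mem n x hx), map_smul, pow_succ]; simp
  · intro x y h h'; simp only [map_add, h, h']; abel

/-! ### The graded tensor product -/

/-- The differential `d ⊗ id + (-1)^∂ ⊗ d` of the graded tensor product. -/
def tensorD : A.gr ᵍ⊗[ℂ] B.gr →ₗ[ℂ] A.gr ᵍ⊗[ℂ] B.gr :=
  (GradedTensorProduct.of ℂ A.gr B.gr).toLinearMap ∘ₗ
    (TensorProduct.map A.d LinearMap.id + TensorProduct.map A.parity B.d) ∘ₗ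
      (GradedTensorProduct.of ℂ A.gr B.gr).symm.toLinearMap

/-- The *-structure `* ⊗ *` of the graded tensor product. -/
def tensorSt (x : A.gr ᵍ⊗[ℂ] B.gr) : A.gr ᵍ⊗[ℂ] B.gr :=
  GradedTensorProduct.of ℂ A.gr B.gr
    (TensorProduct.map A.st B.st ((GradedTensorProduct.of ℂ A.gr B.gr).symm x))

/-- The elements of total degree `n` in the graded tensor product. -/
def tensorGr (n : ℕ) : Submodule ℂ (A.gr ᵍ⊗[ℂ] B.gr) :=
  Submodule.span ℂ {t | ∃ i j, i + j = n ∧ ∃ a ∈ A.gr i, ∃ b ∈ B.gr j, t = a ᵍ⊗ₜ[ℂ] b}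

variable {A B} in
/-- The linear map `f ⊗ id`. -/
def tensorMapLeft (f : A →ₗ[ℂ] B) : A.gr ᵍ⊗[ℂ] C.gr →ₗ[ℂ] B.gr ᵍ⊗[ℂ] C.gr :=
  (GradedTensorProduct.of ℂ B.gr C.gr).toLinearMap ∘ₗ
    TensorProduct.map f LinearMap.id ∘ₗ (GradedTensorProduct.of ℂ A.gr C.gr).symm.toLinearMap

variable {A B}

theorem tensorD_tmul (a : A) (b : B) :
    tensorD A B (a ᵍ⊗ₜ[ℂ] b) = (A.d a) ᵍ⊗ₜ[ℂ] b + (A.parity a) ᵍ⊗ₜ[ℂ] (B.d b) := by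
  simp [tensorD]

theorem tensor_induction {p : A.gr ᵍ⊗[ℂ] B.gr → Prop}
    (h : ∀ i j, ∀ a ∈ A.gr i, ∀ b ∈ B.gr j, p (a ᵍ⊗ₜ[ℂ] b))
    (hadd : ∀ x y, p x → p y → p (x + y)) (x : A.gr ᵍ⊗[ℂ] B.gr) : p x := by
  have key : ∀ t : A ⊗[ℂ] B, p (GradedTensorProduct.of ℂ A.gr B.gr t) := by
    intro t
    induction t using TensorProduct.induction_on with
    | zero => simpa [GradedTensorProduct.tmul] using h 0 0 0 (zero_mem _) 0 (zero_mem _)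
    | add x y hx hy => rw [map_add]; exact hadd _ _ hx hy
    | tmul a b =>
      refine hom_induction A.gr (p := fun a => p (a ᵍ⊗ₜ[ℂ] b)) ?_ ?_ a
      · intro i a ha
        refine hom_induction B.gr (p := fun b => p (a ᵍ⊗ₜ[ℂ] b)) ?_ ?_ b
        · intro j b hb; exact h i j a ha b hb
        · intro x y hx hy
          rw [GradedTensorProduct.tmul, TensorProduct.tmul_add, map_add]; exact hadd _ _ hx hy
      · intro x y hx hy
        rw [GradedTensorProduct.tmul, TensorProduct.add_tmul, map_add]; exact hadd _ _ hx hy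
  exact key ((GradedTensorProduct.of ℂ A.gr B.gr).symm x)

theorem tmul_mul_tmul {i j : ℕ} (a : A) {b : B} (hb : b ∈ B.gr j) {a' : A} (ha' : a' ∈ A.gr i)
    (b' : B) : (a ᵍ⊗ₜ[ℂ] b * a' ᵍ⊗ₜ[ℂ] b' : A.gr ᵍ⊗[ℂ] B.gr) =
      (-1 : ℂ) ^ (j * i) • ((a * a') ᵍ⊗ₜ[ℂ] (b * b')) := by
  have := GradedTensorProduct.tmul_coe_mul_coe_tmul (R := ℂ) A.gr B.gr a ⟨b, hb⟩ ⟨a', ha'⟩ b'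
  rw [this]
  rcases Nat.even_or_odd (j * i) with h | h
  · have h1 : ((-1 : ℤˣ) ^ (j * i)) = 1 := h.neg_one_pow
    simp [h1, h.neg_one_pow]
  · have h1 : ((-1 : ℤˣ) ^ (j * i)) = -1 := h.neg_one_pow
    simp [h1, h.neg_one_pow, Units.smul_def]

theorem tensorGr_mul {m n : ℕ} {x y : A.gr ᵍ⊗[ℂ] B.gr} (hx : x ∈ tensorGr A B m)
    (hy : y ∈ tensorGr A B n) : x * y ∈ tensorGr A B (m + n) := by
  have : tensorGr A B m * tensorGr A B n ≤ tensorGr A B (m + n) := by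
    rw [tensorGr, tensorGr, Submodule.span_mul_span, Submodule.span_le]
    rintro _ ⟨_, ⟨i, j, rfl, a, ha, b, hb, rfl⟩, _, ⟨i', j', rfl, a', ha', b', hb', rfl⟩, rfl⟩
    change (_ * _ : A.gr ᵍ⊗[ℂ] B.gr) ∈ tensorGr A B _
    rw [tmul_mul_tmul a hb ha' b']
    refine Submodule.smul_mem _ _ (Submodule.subset_span ?_)
    exact ⟨i + i', j + j', by omega, _, SetLike.GradedMul.mul_mem ha ha', _,
      SetLike.GradedMul.mul_mem hb hb', rfl⟩
  exact this (Submodule.mul_mem_mul hx hy)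

theorem tmul_mem {i j : ℕ} {a : A} (ha : a ∈ A.gr i) {b : B} (hb : b ∈ B.gr j) :
    (a ᵍ⊗ₜ[ℂ] b : A.gr ᵍ⊗[ℂ] B.gr) ∈ tensorGr A B (i + j) :=
  Submodule.subset_span ⟨i, j, rfl, a, ha, b, hb, rfl⟩

theorem tensorD_mem {n : ℕ} {x : A.gr ᵍ⊗[ℂ] B.gr} (hx : x ∈ tensorGr A B n) :
    tensorD A B x ∈ tensorGr A B (n + 1) := by
  have : tensorGr A B n ≤ (tensorGr A B (n + 1)).comap (tensorD A B) := by
    refine Submodule.span_le.2 ?_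
    rintro _ ⟨i, j, rfl, a, ha, b, hb, rfl⟩
    change tensorD A B _ ∈ tensorGr A B _
    rw [tensorD_tmul, parity_apply ha]
    refine add_mem ?_ ?_
    · have := tmul_mem (A.d_mem i a ha) hb
      rwa [show i + 1 + j = i + j + 1 by omega] at this
    · have := tmul_mem (Submodule.smul_mem (A.gr i) ((-1 : ℂ) ^ i) ha) (B.d_mem j b hb)
      rwa [← add_assoc] at this
  exact this hx

theorem tensorD_tensorD (x : A.gr ᵍ⊗[ℂ] B.gr) : tensorD A B (tensorD A B x) = 0 := by
  refine tensor_induction (p := fun x => tensorD A B (tensorD A B x) = 0) ?_ ?_ x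
  · intro i j a ha b hb
    simp only [tensorD_tmul, map_add, A.d_d, B.d_d, A.d_parity]
    simp [GradedTensorProduct.tmul, TensorProduct.neg_tmul]
  · intro x y hx hy; simp [hx, hy]

theorem tensorD_mul {n : ℕ} {x : A.gr ᵍ⊗[ℂ] B.gr} (hx : x ∈ tensorGr A B n)
    (y : A.gr ᵍ⊗[ℂ] B.gr) :
    tensorD A B (x * y) = tensorD A B x * y + (-1 : ℂ) ^ n • (x * tensorD A B y) := by
  induction hx using Submodule.span_induction with
  | zero => simp
  | add x x' _ _ h h' => simp only [add_mul, map_add, smul_add, h, h']; abel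
  | smul c x _ h => simp only [smul_mul_assoc, map_smul, h, smul_add]; rw [smul_comm]
  | mem x hx =>
    obtain ⟨i, j, rfl, a, ha, b, hb, rfl⟩ := hx
    refine tensor_induction (p := fun y => tensorD A B (a ᵍ⊗ₜ[ℂ] b * y) =
      tensorD A B (a ᵍ⊗ₜ[ℂ] b) * y + (-1 : ℂ) ^ (i + j) • (a ᵍ⊗ₜ[ℂ] b * tensorD A B y)) ?_ ?_ y
    · intro i' j' a' ha' b' hb'
      have hpa := Submodule.smul_mem (A.gr i) ((-1 : ℂ) ^ i) ha
      have hpa' := Submodule.smul_mem (A.gr i') ((-1 : ℂ) ^ i') ha'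
      rw [tmul_mul_tmul a hb ha' b', map_smul, tensorD_tmul, tensorD_tmul, tensorD_tmul,
        parity_apply ha, parity_apply ha', parity_apply (SetLike.GradedMul.mul_mem ha ha'),
        add_mul, mul_add, tmul_mul_tmul _ hb ha', tmul_mul_tmul _ (B.d_mem j b hb) ha',
        tmul_mul_tmul _ hb (A.d_mem i' a' ha'), tmul_mul_tmul _ hb hpa',
        A.d_mul i a ha, B.d_mul j b hb]
      simp only [GradedTensorProduct.tmul, TensorProduct.add_tmul, TensorProduct.tmul_add, map_add,
        smul_mul_assoc, mul_smul_comm, ← TensorProduct.smul_tmul', TensorProduct.tmul_smul, map_smul,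
        smul_add, smul_smul]
      have e1 : (-1 : ℂ) ^ (j * i') * (-1) ^ i = (-1) ^ (i + j) * (-1) ^ (j * (i' + 1)) := by
        have : (-1 : ℂ) ^ (j + j) = 1 := (Even.add_self j).neg_one_pow
        rw [← pow_add, ← pow_add, show i + j + j * (i' + 1) = (j * i' + i) + (j + j) by ring,
          pow_add _ _ (j + j), this, mul_one]
      have e2 : (-1 : ℂ) ^ (j * i') * (-1) ^ (i + i') = (-1) ^ ((j + 1) * i') * (-1) ^ i := by
        rw [← pow_add, ← pow_add]; congr 1; ring
      have e3 : (-1 : ℂ) ^ (j * i') * ((-1) ^ j * (-1) ^ (i + i')) =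
          (-1) ^ (i + j) * ((-1) ^ (j * i') * (-1) ^ i') := by
        simp only [← pow_add]; congr 1; ring
      rw [e1, e2, e3]; abel
    · intro x y hx hy
      simp only [mul_add, map_add, hx, hy, smul_add]; abel

end GDSAlg

/-! ### Homomorphisms, coactions, invariants, cohomology -/

/-- A (unital) homomorphism of differential algebras. -/
structure DGHom (A : GDSAlg.{u}) (B : GDSAlg.{v}) where
  toAlgHom : A →ₐ[ℂ] B
  map_d : ∀ x, toAlgHom (A.d x) = B.d (toAlgHom x)

instance (A : GDSAlg.{u}) (B : GDSAlg.{v}) : CoeFun (DGHom A B) (fun _ => A → B) :=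
  ⟨fun f => f.toAlgHom⟩

/-- A graded-differential homomorphism `A → A ⊗̂ C` into the graded tensor product. -/
structure DGCoaction (A : GDSAlg.{u}) (C : GDSAlg.{v}) where
  toAlgHom : A →ₐ[ℂ] A.gr ᵍ⊗[ℂ] C.gr
  map_mem : ∀ n, ∀ x ∈ A.gr n, toAlgHom x ∈ GDSAlg.tensorGr A C n
  map_d : ∀ x, toAlgHom (A.d x) = GDSAlg.tensorD A C (toAlgHom x)

instance (A : GDSAlg.{u}) (C : GDSAlg.{v}) :
    CoeFun (DGCoaction A C) (fun _ => A → A.gr ᵍ⊗[ℂ] C.gr) :=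
  ⟨fun f => f.toAlgHom⟩

/-- A graded-differential subalgebra. -/
structure DGSub (A : GDSAlg.{u}) where
  toSubalgebra : Subalgebra ℂ A
  proj_mem : ∀ n, ∀ x ∈ toSubalgebra, A.proj n x ∈ toSubalgebra
  d_mem : ∀ x ∈ toSubalgebra, A.d x ∈ toSubalgebra

instance (A : GDSAlg.{u}) : Membership A (DGSub A) := ⟨fun K x => x ∈ K.toSubalgebra⟩

namespace DGCoaction

variable {A : GDSAlg.{u}} {C : GDSAlg.{v}} (Φ : DGCoaction A C)

/-- The projection of the graded tensor product onto total degree `n`. -/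
def totalProj (A : GDSAlg.{u}) (C : GDSAlg.{v}) (n : ℕ) :
    A.gr ᵍ⊗[ℂ] C.gr →ₗ[ℂ] A.gr ᵍ⊗[ℂ] C.gr :=
  (GradedTensorProduct.of ℂ A.gr C.gr).toLinearMap ∘ₗ
    (∑ p ∈ Finset.HasAntidiagonal.antidiagonal n, TensorProduct.map (A.proj p.1) (C.proj p.2)) ∘ₗ
      (GradedTensorProduct.of ℂ A.gr C.gr).symm.toLinearMap

theorem totalProj_apply {n m : ℕ} {x : A.gr ᵍ⊗[ℂ] C.gr}
    (hx : x ∈ GDSAlg.tensorGr A C m) : totalProj A C n x = if n = m then x else 0 := by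
  induction hx using Submodule.span_induction with
  | zero => simp
  | add x y _ _ h h' => rw [map_add, h, h']; split_ifs <;> simp
  | smul c x _ h => rw [map_smul, h]; split_ifs <;> simp
  | mem x hx =>
    obtain ⟨i, j, rfl, a, ha, c, hc, rfl⟩ := hx
    have : totalProj A C n (a ᵍ⊗ₜ[ℂ] c) = ∑ p ∈ Finset.HasAntidiagonal.antidiagonal n,
        ((A.proj p.1 a) ᵍ⊗ₜ[ℂ] (C.proj p.2 c) : A.gr ᵍ⊗[ℂ] C.gr) := by
      simp [totalProj]
    rw [this]
    split_ifs with h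
    · subst h
      rw [Finset.sum_eq_single (i, j)]
      · simp only [proj_of_mem _ ha, proj_of_mem _ hc, if_true]
      · rintro ⟨p, q⟩ _ hpq
        simp only [proj_of_mem _ ha, proj_of_mem _ hc]
        by_cases hp : p = i
        · have hq : q ≠ j := fun hq => hpq (by rw [hp, hq])
          simp [hq, GradedTensorProduct.tmul]
        · simp [hp, GradedTensorProduct.tmul]
      · intro h; simp at h
    · refine Finset.sum_eq_zero ?_
      rintro ⟨p, q⟩ hpq
      have hpq' := Finset.HasAntidiagonal.mem_antidiagonal.1 hpq
      simp only [proj_of_mem _ ha, proj_of_mem _ hc]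
      by_cases hp : p = i
      · have hq : q ≠ j := fun hq => h (by rw [← hpq', ← hp, ← hq])
        simp [hq, GradedTensorProduct.tmul]
      · simp [hp, GradedTensorProduct.tmul]

theorem map_proj (n : ℕ) (x : A) : Φ (A.proj n x) = totalProj A C n (Φ x) := by
  refine hom_induction A.gr (p := fun x => Φ (A.proj n x) = totalProj A C n (Φ x)) ?_ ?_ x
  · intro m x hx
    rw [totalProj_apply (Φ.map_mem m x hx), proj_of_mem _ hx]
    split_ifs <;> simp
  · intro x y h h'; simp only [map_add, h, h']

/-- The graded-differential subalgebra of invariant elements, `Φ w = w ⊗ 1`. -/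
def invariants : DGSub A where
  toSubalgebra := AlgHom.equalizer Φ.toAlgHom (GradedTensorProduct.includeLeft A.gr C.gr)
  proj_mem := by
    intro n x hx
    have hx' : Φ x = x ᵍ⊗ₜ[ℂ] 1 := hx
    change Φ (A.proj n x) = (A.proj n x) ᵍ⊗ₜ[ℂ] (1 : C)
    rw [map_proj, hx']
    refine hom_induction A.gr
      (p := fun x => totalProj A C n (x ᵍ⊗ₜ[ℂ] (1 : C)) = (A.proj n x) ᵍ⊗ₜ[ℂ] (1 : C)) ?_ ?_ x
    · intro m x hx
      rw [totalProj_apply (by simpa using GDSAlg.tmul_mem hx C.one_mem), proj_of_mem _ hx]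
      split_ifs <;> simp [GradedTensorProduct.tmul]
    · intro x y h h'
      simp only [GradedTensorProduct.tmul, TensorProduct.add_tmul, map_add] at h h' ⊢
      rw [h, h']
  d_mem := by
    intro x hx
    have hx' : Φ x = x ᵍ⊗ₜ[ℂ] 1 := hx
    change Φ (A.d x) = (A.d x) ᵍ⊗ₜ[ℂ] (1 : C)
    rw [Φ.map_d, hx', GDSAlg.tensorD_tmul, C.d_one]
    simp [GradedTensorProduct.tmul]

theorem mem_invariants (x : A) : x ∈ Φ.invariants ↔ Φ x = x ᵍ⊗ₜ[ℂ] (1 : C) := Iff.rfl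

end DGCoaction

namespace DGSub

variable {A : GDSAlg.{u}} {B : GDSAlg.{v}} (K : DGSub A) (K' : DGSub B)

theorem parity_mem (x : A) (hx : x ∈ K) : A.parity x ∈ K := by
  obtain ⟨N, hN⟩ := sum_proj A.gr x
  rw [hN, map_sum]
  refine K.toSubalgebra.sum_mem fun n _ => ?_
  rw [GDSAlg.parity_apply (QPB.proj_mem A.gr n x)]
  exact K.toSubalgebra.smul_mem (K.proj_mem n x hx) _

/-- The algebra of closed elements of a graded-differential subalgebra. -/
def cocycles : Subalgebra ℂ A where
  carrier := {x | x ∈ K ∧ A.d x = 0}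
  mul_mem' := by
    rintro x y ⟨hx, hx'⟩ ⟨hy, hy'⟩
    exact ⟨K.toSubalgebra.mul_mem hx hy, by rw [A.leibniz, hx', hy']; simp⟩
  add_mem' := by
    rintro x y ⟨hx, hx'⟩ ⟨hy, hy'⟩
    exact ⟨K.toSubalgebra.add_mem hx hy, by rw [map_add, hx', hy', add_zero]⟩
  algebraMap_mem' := by
    intro r
    exact ⟨K.toSubalgebra.algebraMap_mem r, by
      rw [Algebra.algebraMap_eq_smul_one, map_smul, A.d_one, smul_zero]⟩

/-- The ideal of exact elements (differentials of elements of the subalgebra). -/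
def coboundaries : Ideal K.cocycles where
  carrier := {z | ∃ y ∈ K, A.d y = z}
  add_mem' := by
    rintro x y ⟨a, ha, hx⟩ ⟨b, hb, hy⟩
    exact ⟨a + b, K.toSubalgebra.add_mem ha hb, by simp [hx, hy]⟩
  zero_mem' := ⟨0, K.toSubalgebra.zero_mem, by simp⟩
  smul_mem' := by
    rintro c x ⟨a, ha, hx⟩
    refine ⟨A.parity c * a, K.toSubalgebra.mul_mem (K.parity_mem c c.2.1) ha, ?_⟩
    have hc : A.d c = 0 := c.2.2
    simp [A.leibniz, A.d_parity, hc, A.parity_parity, hx]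

instance : K.coboundaries.IsTwoSided where
  mul_mem_of_left := by
    rintro x c ⟨a, ha, h⟩
    refine ⟨a * c, K.toSubalgebra.mul_mem ha c.2.1, ?_⟩
    have hc : A.d c = 0 := c.2.2
    simp [A.leibniz, hc, h]

/-- The cohomology algebra of a graded-differential subalgebra. -/
abbrev Cohomology : Type u := K.cocycles ⧸ K.coboundaries

variable {K K'}

/-- The homomorphism of cohomology algebras induced by a homomorphism `f` of differential algebras
that maps `K` into `K'`. -/
def cohomologyMap (f : DGHom A B) (hf : ∀ x ∈ K, f x ∈ K') : K.Cohomology →ₐ[ℂ] K'.Cohomology :=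
  Ideal.quotientMapₐ K'.coboundaries
    ((f.toAlgHom.comp K.cocycles.val).codRestrict K'.cocycles
      (fun x => ⟨hf x x.2.1, by
        have := f.map_d x
        rw [x.2.2, map_zero] at this
        exact this.symm⟩))
    (by
      rintro x ⟨y, hy, h⟩
      exact ⟨f y, hf y hy, by rw [← f.map_d, h]; rfl⟩)

end DGSub

/-! ### Free graded-differential *-algebras -/

section Conj

variable (B : Type*) [Ring B] [Algebra ℂ B]

/-- The opposite algebra with the conjugate scalar multiplication; algebra homomorphisms into it are
antilinear antimultiplicative maps. -/
def ConjOp : Type _ := Bᵐᵒᵖ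

instance : Ring (ConjOp B) := inferInstanceAs (Ring Bᵐᵒᵖ)

instance : Algebra ℂ (ConjOp B) :=
  RingHom.toAlgebra' ((algebraMap ℂ Bᵐᵒᵖ).comp (starRingEnd ℂ) : ℂ →+* Bᵐᵒᵖ)
    (fun c x => Algebra.commutes (A := Bᵐᵒᵖ) (starRingEnd ℂ c) x)

theorem ConjOp.unop_smul (c : ℂ) (x : ConjOp B) :
    MulOpposite.unop (c • x : ConjOp B) = (starRingEnd ℂ c) • (MulOpposite.unop x : B) := by
  rw [Algebra.smul_def]
  change MulOpposite.unop ((algebraMap ℂ Bᵐᵒᵖ (starRingEnd ℂ c) : Bᵐᵒᵖ) * (show Bᵐᵒᵖ from x)) = _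
  rw [MulOpposite.unop_mul]
  change (MulOpposite.unop x : B) * algebraMap ℂ B (starRingEnd ℂ c) = _
  rw [← Algebra.commutes, ← Algebra.smul_def]

end Conj

namespace Free

variable {V : Type u} [AddCommGroup V] [Module ℂ V]

/-- The generators of the free graded-differential algebra: `inl v` stands for `v` and `inr v` for
`d v`. -/
def gen : V ⊕ V → TensorAlgebra ℂ (V × V)
  | Sum.inl v => TensorAlgebra.ι ℂ (v, 0)
  | Sum.inr v => TensorAlgebra.ι ℂ (0, v)

/-- The degree of a generator, if `V` is placed in degree `k`. -/
def wt (k : ℕ) : V ⊕ V → ℕ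
  | Sum.inl _ => k
  | Sum.inr _ => k + 1

variable (V) in
/-- The span of the words of degree `n` in the generators. -/
def gr (k n : ℕ) : Submodule ℂ (TensorAlgebra ℂ (V × V)) :=
  Submodule.span ℂ {x | ∃ l : List (V ⊕ V), (l.map (wt k)).sum = n ∧ x = (l.map gen).prod}

theorem gen_mem (k : ℕ) (g : V ⊕ V) : gen g ∈ gr V k (wt k g) :=
  Submodule.subset_span ⟨[g], by simp, by simp⟩

theorem word_mem (k : ℕ) (l : List (V ⊕ V)) : (l.map gen).prod ∈ gr V k (l.map (wt k)).sum :=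
  Submodule.subset_span ⟨l, rfl, rfl⟩

theorem ι_eq (v v' : V) : TensorAlgebra.ι ℂ (v, v') = gen (Sum.inl v) + gen (Sum.inr v') := by
  simp [gen, ← map_add]

instance gradedMonoid (k : ℕ) : SetLike.GradedMonoid (gr V k) where
  one_mem := Submodule.subset_span ⟨[], by simp, by simp⟩
  mul_mem := by
    intro m n x y hx hy
    have : gr V k m * gr V k n ≤ gr V k (m + n) := by
      rw [gr, gr, Submodule.span_mul_span, Submodule.span_le]
      rintro _ ⟨_, ⟨l, rfl, rfl⟩, _, ⟨l', rfl, rfl⟩, rfl⟩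
      exact Submodule.subset_span ⟨l ++ l', by simp, by simp⟩
    exact this (Submodule.mul_mem_mul hx hy)

/-- The map into the direct sum of the homogeneous components. -/
def decomp (k : ℕ) : TensorAlgebra ℂ (V × V) →ₐ[ℂ] ⨁ n, gr V k n :=
  TensorAlgebra.lift ℂ
    (LinearMap.coprod
      (DirectSum.lof ℂ ℕ (fun n => gr V k n) k ∘ₗ LinearMap.codRestrict _
        (TensorAlgebra.ι ℂ ∘ₗ LinearMap.inl ℂ V V) (fun v => gen_mem k (Sum.inl v)))
      (DirectSum.lof ℂ ℕ (fun n => gr V k n) (k + 1) ∘ₗ LinearMap.codRestrict _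
        (TensorAlgebra.ι ℂ ∘ₗ LinearMap.inr ℂ V V) (fun v => gen_mem k (Sum.inr v))))

theorem decomp_gen (k : ℕ) (g : V ⊕ V) :
    decomp k (gen g) = DirectSum.of (fun n => gr V k n) (wt k g) ⟨gen g, gen_mem k g⟩ := by
  rcases g with v | v
  · simp only [gen, decomp, TensorAlgebra.lift_ι_apply, LinearMap.coprod_apply, map_zero, add_zero]
    rfl
  · simp only [gen, decomp, TensorAlgebra.lift_ι_apply, LinearMap.coprod_apply, map_zero, zero_add]
    rfl

theorem decomp_word (k : ℕ) (l : List (V ⊕ V)) :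
    decomp k (l.map gen).prod = DirectSum.of (fun n => gr V k n) _ ⟨_, word_mem k l⟩ := by
  induction l with
  | nil => simp only [List.map_nil, List.prod_nil, map_one]; rfl
  | cons g l ih =>
    simp only [List.map_cons, List.prod_cons, map_mul, ih, decomp_gen, DirectSum.of_mul_of]
    rfl

instance graded (k : ℕ) : GradedAlgebra (gr V k) :=
  GradedAlgebra.ofAlgHom _ (decomp k)
    (by
      ext v
      · have := decomp_gen k (Sum.inl v)
        simp only [gen] at this
        simp [this]
      · have := decomp_gen k (Sum.inr v)
        simp only [gen] at this
        simp [this])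
    (by
      rintro n ⟨x, hx⟩
      simp only
      induction hx using Submodule.span_induction with
      | zero => rw [map_zero]; exact (map_zero (DirectSum.of (fun n => gr V k n) n)).symm
      | add x y hx hy ihx ihy => rw [map_add, ihx, ihy, ← map_add]; rfl
      | smul c x hx ih =>
        rw [map_smul, ih, ← DirectSum.lof_eq_of ℂ, ← DirectSum.lof_eq_of ℂ, ← map_smul]; rfl
      | mem x hx =>
        obtain ⟨l, rfl, rfl⟩ := hx
        exact decomp_word k l)

/-- Induction along words. -/
theorem word_induction {p : TensorAlgebra ℂ (V × V) → Prop} (h1 : p 1)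
    (hgen : ∀ g x, p x → p (gen g * x)) (hadd : ∀ x y, p x → p y → p (x + y))
    (hsmul : ∀ (c : ℂ) x, p x → p (c • x)) (x : TensorAlgebra ℂ (V × V)) : p x := by
  refine hom_induction (gr V 0) (fun n x hx => ?_) hadd x
  induction hx using Submodule.span_induction with
  | zero => simpa using hsmul 0 1 h1
  | add x y _ _ ihx ihy => exact hadd _ _ ihx ihy
  | smul c x _ ih => exact hsmul c x ih
  | mem x hx =>
    obtain ⟨l, -, rfl⟩ := hx
    induction l with
    | nil => simpa using h1
    | cons g l ih => simpa using hgen g _ ih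

/-- The parity automorphism. -/
def par (k : ℕ) : TensorAlgebra ℂ (V × V) →ₐ[ℂ] TensorAlgebra ℂ (V × V) :=
  TensorAlgebra.lift ℂ (TensorAlgebra.ι ℂ ∘ₗ
    LinearMap.prodMap ((-1 : ℂ) ^ k • LinearMap.id) ((-1 : ℂ) ^ (k + 1) • LinearMap.id))

theorem par_gen (k : ℕ) (g : V ⊕ V) : par k (gen g) = (-1 : ℂ) ^ (wt k g) • gen g := by
  rcases g with v | v
  · simp only [par, gen, wt, TensorAlgebra.lift_ι_apply, LinearMap.comp_apply]
    rw [← map_smul]; congr 1; ext <;> simp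
  · simp only [par, gen, wt, TensorAlgebra.lift_ι_apply, LinearMap.comp_apply]
    rw [← map_smul]; congr 1; ext <;> simp

theorem par_apply {k n : ℕ} {x : TensorAlgebra ℂ (V × V)} (hx : x ∈ gr V k n) :
    par k x = (-1 : ℂ) ^ n • x := by
  induction hx using Submodule.span_induction with
  | zero => simp
  | add x y _ _ h h' => rw [map_add, h, h', smul_add]
  | smul c x _ h => rw [map_smul, h, smul_comm]
  | mem x hx =>
    obtain ⟨l, rfl, rfl⟩ := hx
    induction l with
    | nil => simp
    | cons g l ih =>
      simp only [List.map_cons, List.prod_cons, List.sum_cons, map_mul, ih, par_gen, pow_add,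
        smul_mul_smul_comm]

/-- The homomorphism `x ↦ !![par x, d x; 0, x]` encoding the differential. -/
def dMat (k : ℕ) : TensorAlgebra ℂ (V × V) →ₐ[ℂ] Matrix (Fin 2) (Fin 2) (TensorAlgebra ℂ (V × V)) :=
  TensorAlgebra.lift ℂ
    { toFun := fun v => !![par k (TensorAlgebra.ι ℂ v), TensorAlgebra.ι ℂ (LinearMap.inr ℂ V V v.1);
        0, TensorAlgebra.ι ℂ v]
      map_add' := by
        intro x y
        ext i j
        fin_cases i <;> fin_cases j <;> simp [-LinearMap.coe_inr]
      map_smul' := by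
        intro c x
        ext i j
        fin_cases i <;> fin_cases j <;> simp [-LinearMap.coe_inr] }

theorem dMat_apply (k : ℕ) (x : TensorAlgebra ℂ (V × V)) :
    dMat k x = !![par k x, dMat k x 0 1; 0, x] := by
  have h10 : ∀ x : TensorAlgebra ℂ (V × V), dMat k x 1 0 = 0 ∧ dMat k x 0 0 = par k x ∧
      dMat k x 1 1 = x := by
    intro x
    induction x using TensorAlgebra.induction with
    | algebraMap r => simp [Matrix.algebraMap_matrix_apply]
    | ι v => simp [dMat]
    | mul x y hx hy =>
      obtain ⟨a, b, c⟩ := hx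
      obtain ⟨a', b', c'⟩ := hy
      simp [Matrix.mul_apply, Fin.sum_univ_two, a, b, c, a', b', c']
    | add x y hx hy =>
      obtain ⟨a, b, c⟩ := hx
      obtain ⟨a', b', c'⟩ := hy
      simp [a, b, c, a', b', c']
  obtain ⟨a, b, c⟩ := h10 x
  ext i j
  fin_cases i <;> fin_cases j <;> simp [a, b, c]

/-- The differential: the antiderivation with `d v = (0, v)` and `d (0, v) = 0` on generators. -/
def d (k : ℕ) : TensorAlgebra ℂ (V × V) →ₗ[ℂ] TensorAlgebra ℂ (V × V) where
  toFun x := dMat k x 0 1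
  map_add' := by simp
  map_smul' := by simp

theorem d_mul (k : ℕ) (x y : TensorAlgebra ℂ (V × V)) :
    d k (x * y) = d k x * y + par k x * d k y := by
  change dMat k (x * y) 0 1 = dMat k x 0 1 * y + par k x * dMat k y 0 1
  rw [map_mul, dMat_apply k x, dMat_apply k y]
  simp [Matrix.mul_apply, Fin.sum_univ_two, add_comm]

theorem d_inl (k : ℕ) (v : V) : d k (gen (Sum.inl v)) = gen (Sum.inr v) := by
  simp [d, dMat, gen]

theorem d_inr (k : ℕ) (v : V) : d k (gen (Sum.inr v)) = 0 := by
  change dMat k _ 0 1 = 0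
  simp [dMat, gen]

theorem d_one (k : ℕ) : d k (1 : TensorAlgebra ℂ (V × V)) = 0 := by
  simp [d]

theorem d_gen_mem (k : ℕ) (g : V ⊕ V) : d k (gen g) ∈ gr V k (wt k g + 1) := by
  rcases g with v | v
  · rw [d_inl]; exact gen_mem k (Sum.inr v)
  · rw [d_inr]; exact zero_mem _

theorem d_mem (k n : ℕ) (x : TensorAlgebra ℂ (V × V)) (hx : x ∈ gr V k n) :
    d k x ∈ gr V k (n + 1) := by
  induction hx using Submodule.span_induction with
  | zero => simp
  | add x y _ _ h h' => rw [map_add]; exact add_mem h h'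
  | smul c x _ h => rw [map_smul]; exact Submodule.smul_mem _ _ h
  | mem x hx =>
    obtain ⟨l, rfl, rfl⟩ := hx
    induction l with
    | nil => simp [d_one]
    | cons g l ih =>
      simp only [List.map_cons, List.prod_cons, List.sum_cons, d_mul, par_gen]
      refine add_mem ?_ ?_
      · have := SetLike.GradedMul.mul_mem (d_gen_mem k g) (word_mem k l)
        rwa [add_right_comm] at this
      · rw [smul_mul_assoc, add_assoc]
        exact Submodule.smul_mem _ _ (SetLike.GradedMul.mul_mem (gen_mem k g) ih)

theorem par_par (k : ℕ) (x : TensorAlgebra ℂ (V × V)) : par k (par k x) = x := by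
  refine word_induction (p := fun x => par k (par k x) = x) ?_ ?_ ?_ ?_ x
  · simp
  · intro g x h
    rw [map_mul, par_gen, map_mul, map_smul, par_gen, smul_smul, ← mul_pow, h]; simp
  · intro x y h h'; simp [h, h']
  · intro c x h; simp [h]

theorem d_par (k : ℕ) (x : TensorAlgebra ℂ (V × V)) : d k (par k x) = - par k (d k x) := by
  refine hom_induction (gr V k) (p := fun x => d k (par k x) = - par k (d k x)) ?_ ?_ x
  · intro n x hx
    rw [par_apply hx, par_apply (d_mem k n x hx), map_smul, pow_succ]; simp
  · intro x y h h'; simp only [map_add, h, h']; abel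

theorem d_d (k : ℕ) (x : TensorAlgebra ℂ (V × V)) : d k (d k x) = 0 := by
  refine word_induction (p := fun x => d k (d k x) = 0) ?_ ?_ ?_ ?_ x
  · simp [d_one]
  · intro g x h
    have hg : d k (d k (gen g)) = 0 := by
      rcases g with v | v
      · rw [d_inl, d_inr]
      · rw [d_inr, map_zero]
    rw [d_mul, map_add, d_mul, d_mul, hg, h, d_par]; simp
  · intro x y h h'; simp [h, h']
  · intro c x h; simp [h]

/-- The sign `(-1)^(n(n-1)/2)` of the reversal of `n` factors of degree one. -/
def sgn (n : ℕ) : ℂ := (-1) ^ (n * (n - 1) / 2)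

theorem sgn_succ (n : ℕ) : sgn (n + 1) = sgn n * (-1) ^ n := by
  rw [sgn, sgn, ← pow_add, Nat.triangle_succ]

theorem sgn_add (m n : ℕ) : sgn (m + n) = sgn m * sgn n * (-1) ^ (m * n) := by
  induction n with
  | zero => simp [sgn]
  | succ n ih =>
    rw [← add_assoc, sgn_succ, ih, sgn_succ, pow_add, mul_add, mul_one, pow_add]; ring

theorem sgn_mul_self (n : ℕ) : sgn n * sgn n = 1 := by
  rw [sgn, ← mul_pow]; simp

theorem star_sgn (n : ℕ) : starRingEnd ℂ (sgn n) = sgn n := by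
  simp [sgn]

variable (s : V →ₛₗ[starRingEnd ℂ] V)

/-- The antilinear antimultiplicative map acting on the generators as `sgn` times `s`. -/
def revHom (k : ℕ) : TensorAlgebra ℂ (V × V) →ₐ[ℂ] ConjOp (TensorAlgebra ℂ (V × V)) :=
  TensorAlgebra.lift ℂ
    { toFun := fun v => (MulOpposite.op
        (TensorAlgebra.ι ℂ (sgn k • s v.1, sgn (k + 1) • s v.2)) : (TensorAlgebra ℂ (V × V))ᵐᵒᵖ)
      map_add' := by
        intro x y
        apply MulOpposite.unop_injective
        change TensorAlgebra.ι ℂ _ = TensorAlgebra.ι ℂ _ + TensorAlgebra.ι ℂ _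
        rw [← map_add]; congr 1; ext <;> simp
      map_smul' := by
        intro c x
        apply MulOpposite.unop_injective
        refine Eq.trans ?_ (ConjOp.unop_smul _ _ _).symm
        change TensorAlgebra.ι ℂ _ = _ • TensorAlgebra.ι ℂ _
        rw [← LinearMap.map_smul (TensorAlgebra.ι ℂ)]; congr 1
        ext <;> simp [smul_smul, mul_comm] }

/-- The map of `revHom` as an antilinear map. -/
def rev (k : ℕ) : TensorAlgebra ℂ (V × V) →ₛₗ[starRingEnd ℂ] TensorAlgebra ℂ (V × V) where
  toFun x := MulOpposite.unop (revHom s k x : (TensorAlgebra ℂ (V × V))ᵐᵒᵖ)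
  map_add' x y := by rw [map_add]; rfl
  map_smul' c x := by rw [map_smul]; exact ConjOp.unop_smul _ _ _

theorem rev_mul (k : ℕ) (x y : TensorAlgebra ℂ (V × V)) :
    rev s k (x * y) = rev s k y * rev s k x := by
  change MulOpposite.unop (revHom s k (x * y) : (TensorAlgebra ℂ (V × V))ᵐᵒᵖ) = _
  rw [map_mul]; rfl

theorem rev_one (k : ℕ) : rev s k 1 = 1 := by
  change MulOpposite.unop (revHom s k 1 : (TensorAlgebra ℂ (V × V))ᵐᵒᵖ) = _
  rw [map_one]; rfl

theorem rev_gen (k : ℕ) (g : V ⊕ V) :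
    rev s k (gen g) = sgn (wt k g) • gen (Sum.map s s g) := by
  rcases g with v | v
  · change MulOpposite.unop (revHom s k _ : (TensorAlgebra ℂ (V × V))ᵐᵒᵖ) = _
    simp only [revHom, gen, TensorAlgebra.lift_ι_apply]
    change TensorAlgebra.ι ℂ (sgn k • s v, sgn (k + 1) • s 0) = sgn k • TensorAlgebra.ι ℂ (s v, 0)
    rw [← LinearMap.map_smul (TensorAlgebra.ι ℂ)]; congr 1; ext <;> simp
  · change MulOpposite.unop (revHom s k _ : (TensorAlgebra ℂ (V × V))ᵐᵒᵖ) = _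
    simp only [revHom, gen, TensorAlgebra.lift_ι_apply]
    change TensorAlgebra.ι ℂ (sgn k • s 0, sgn (k + 1) • s v) =
      sgn (k + 1) • TensorAlgebra.ι ℂ (0, s v)
    rw [← LinearMap.map_smul (TensorAlgebra.ι ℂ)]; congr 1; ext <;> simp

theorem wt_map (k : ℕ) (g : V ⊕ V) : wt k (Sum.map s s g) = wt k g := by
  rcases g with v | v <;> rfl

theorem rev_gen_mem (k : ℕ) (g : V ⊕ V) : rev s k (gen g) ∈ gr V k (wt k g) := by
  rw [rev_gen]
  have := gen_mem k (Sum.map s s g)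
  rw [wt_map] at this
  exact Submodule.smul_mem _ _ this

theorem rev_mem (k n : ℕ) (x : TensorAlgebra ℂ (V × V)) (hx : x ∈ gr V k n) :
    rev s k x ∈ gr V k n := by
  induction hx using Submodule.span_induction with
  | zero => simp
  | add x y _ _ h h' => rw [map_add]; exact add_mem h h'
  | smul c x _ h => rw [LinearMap.map_smulₛₗ]; exact Submodule.smul_mem _ _ h
  | mem x hx =>
    obtain ⟨l, rfl, rfl⟩ := hx
    induction l with
    | nil => simpa [rev_one] using SetLike.GradedOne.one_mem (A := gr V k)
    | cons g l ih =>
      simp only [List.map_cons, List.prod_cons, List.sum_cons, rev_mul]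
      rw [add_comm]
      exact SetLike.GradedMul.mul_mem ih (rev_gen_mem s k g)

theorem rev_rev (hs : ∀ v, s (s v) = v) (k : ℕ) (x : TensorAlgebra ℂ (V × V)) :
    rev s k (rev s k x) = x := by
  refine word_induction (p := fun x => rev s k (rev s k x) = x) ?_ ?_ ?_ ?_ x
  · simp [rev_one]
  · intro g x h
    have hg : Sum.map s s (Sum.map s s g) = g := by rcases g with v | v <;> simp [hs]
    rw [rev_mul, rev_mul, h, rev_gen, LinearMap.map_smulₛₗ, rev_gen, wt_map, hg, star_sgn,
      smul_smul, sgn_mul_self, one_smul]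
  · intro x y h h'; simp [h, h']
  · intro c x h; simp [h]

theorem rev_par (k : ℕ) (x : TensorAlgebra ℂ (V × V)) : rev s k (par k x) = par k (rev s k x) := by
  refine hom_induction (gr V k) (p := fun x => rev s k (par k x) = par k (rev s k x)) ?_ ?_ x
  · intro n x hx
    rw [par_apply hx, par_apply (rev_mem s k n x hx), LinearMap.map_smulₛₗ]; simp
  · intro x y h h'; simp only [map_add, h, h']

theorem rev_d (k : ℕ) (x : TensorAlgebra ℂ (V × V)) :
    rev s k (d k x) = d k (rev s k (par k x)) := by
  refine word_induction (p := fun x => rev s k (d k x) = d k (rev s k (par k x))) ?_ ?_ ?_ ?_ x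
  · simp [rev_one, d_one]
  · intro g x h
    have hg : rev s k (d k (gen g)) = d k (rev s k (par k (gen g))) := by
      rcases g with v | v
      · rw [d_inl, rev_gen, par_gen, LinearMap.map_smulₛₗ, rev_gen, map_smul, map_smul]
        simp only [Sum.map_inl, Sum.map_inr, d_inl, wt, smul_smul, sgn_succ]
        simp [mul_comm]
      · rw [d_inr, par_gen, LinearMap.map_smulₛₗ, rev_gen, map_smul, map_smul]
        simp [d_inr]
    rw [d_mul, map_add, rev_mul, rev_mul, h, hg, map_mul, rev_mul, d_mul, rev_par s k x, par_par]
    rw [add_comm]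
  · intro x y h h'; simp [h, h']
  · intro c x h; simp [h]

/-- The *-structure of the free graded-differential algebra. -/
def st (k : ℕ) : TensorAlgebra ℂ (V × V) →ₛₗ[starRingEnd ℂ] TensorAlgebra ℂ (V × V) :=
  (gradeScale (gr V k) sgn).comp (rev s k)

theorem st_apply {k n : ℕ} {x : TensorAlgebra ℂ (V × V)} (hx : x ∈ gr V k n) :
    st s k x = sgn n • rev s k x :=
  gradeScale_apply _ _ (rev_mem s k n x hx)

end Free

/-- The free graded-differential *-algebra generated by a vector space `V` with an antilinear
involution `s`, placed in degree `k`: the tensor algebra over `V ⊕ dV`. -/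
def free (V : Type u) [AddCommGroup V] [Module ℂ V] (s : V →ₛₗ[starRingEnd ℂ] V)
    (hs : ∀ v, s (s v) = v) (k : ℕ) : GDSAlg.{u} where
  carrier := TensorAlgebra ℂ (V × V)
  gr := Free.gr V k
  d := Free.d k
  st := Free.st s k
  d_mem := Free.d_mem k
  d_d := Free.d_d k
  d_mul := by
    intro n x hx y
    rw [Free.d_mul, Free.par_apply hx, smul_mul_assoc]
  st_mem := by
    intro n x hx
    rw [Free.st_apply s hx]
    exact Submodule.smul_mem _ _ (Free.rev_mem s k n x hx)
  st_st := by
    intro x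
    refine hom_induction (Free.gr V k) (p := fun x => Free.st s k (Free.st s k x) = x) ?_ ?_ x
    · intro n x hx
      rw [Free.st_apply s hx, LinearMap.map_smulₛₗ, Free.st_apply s (Free.rev_mem s k n x hx),
        Free.rev_rev s hs, Free.star_sgn, smul_smul, Free.sgn_mul_self, one_smul]
    · intro x y h h'; simp [h, h']
  st_mul := by
    intro m n x hx y hy
    rw [Free.st_apply s (SetLike.GradedMul.mul_mem hx hy), Free.st_apply s hx, Free.st_apply s hy,
      Free.rev_mul, smul_mul_smul_comm, smul_smul, Free.sgn_add]
    congr 1; ring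
  st_d := by
    intro x
    refine hom_induction (Free.gr V k)
      (p := fun x => Free.st s k (Free.d k x) = Free.d k (Free.st s k x)) ?_ ?_ x
    · intro n x hx
      rw [Free.st_apply s hx, Free.st_apply s (Free.d_mem k n x hx), Free.rev_d, Free.par_apply hx,
        LinearMap.map_smulₛₗ, map_smul, map_smul, smul_smul, Free.sgn_succ]
      congr 1
      have : (-1 : ℂ) ^ n * (-1) ^ n = 1 := by rw [← mul_pow]; simp
      simp [mul_assoc, this]
    · intro x y h h'; simp [h, h']

/-! ### Quotients -/

section Lift

variable {M N L : Type*} [AddCommGroup M] [Module ℂ M] [AddCommGroup N] [Module ℂ N]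
  [AddCommGroup L] [Module ℂ L] {σ : ℂ →+* ℂ}

/-- The (semi)linear map `g` with `g ∘ p = f`, for a surjection `p` whose kernel is killed by `f`. -/
def liftSurj (p : M →ₗ[ℂ] N) (hp : Function.Surjective p) (f : M →ₛₗ[σ] L)
    (h : ∀ x, p x = 0 → f x = 0) : N →ₛₗ[σ] L where
  toFun y := f (Function.surjInv hp y)
  map_add' x y := by
    rw [← sub_eq_zero, ← map_add, ← map_sub]
    apply h
    simp [Function.surjInv_eq]
  map_smul' c x := by
    rw [← sub_eq_zero, ← LinearMap.map_smulₛₗ, ← map_sub]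
    apply h
    simp [Function.surjInv_eq]

theorem liftSurj_apply (p : M →ₗ[ℂ] N) (hp : Function.Surjective p) (f : M →ₛₗ[σ] L)
    (h : ∀ x, p x = 0 → f x = 0) (x : M) : liftSurj p hp f h (p x) = f x := by
  change f _ = f x
  rw [← sub_eq_zero, ← map_sub]
  apply h
  simp [Function.surjInv_eq]

end Lift

/-- A graded-differential *-ideal. -/
structure DGIdeal (A : GDSAlg.{u}) where
  toIdeal : Ideal A
  mul_mem_right : ∀ x ∈ toIdeal, ∀ y, x * y ∈ toIdeal
  proj_mem : ∀ n, ∀ x ∈ toIdeal, A.proj n x ∈ toIdeal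
  d_mem : ∀ x ∈ toIdeal, A.d x ∈ toIdeal
  st_mem : ∀ x ∈ toIdeal, A.st x ∈ toIdeal

namespace DGIdeal

variable {A : GDSAlg.{u}} (I : DGIdeal A)

instance : I.toIdeal.IsTwoSided := ⟨fun {a} b ha => I.mul_mem_right a ha b⟩

/-- The smallest graded-differential *-ideal containing a given set. -/
def span (S : Set A) : DGIdeal A where
  toIdeal := sInf {J | ∃ I : DGIdeal A, I.toIdeal = J ∧ S ⊆ J}
  mul_mem_right := by
    intro x hx y
    simp only [Submodule.mem_sInf] at hx ⊢
    rintro _ ⟨I, rfl, hI⟩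
    exact I.mul_mem_right x (hx _ ⟨I, rfl, hI⟩) y
  proj_mem := by
    intro n x hx
    simp only [Submodule.mem_sInf] at hx ⊢
    rintro _ ⟨I, rfl, hI⟩
    exact I.proj_mem n x (hx _ ⟨I, rfl, hI⟩)
  d_mem := by
    intro x hx
    simp only [Submodule.mem_sInf] at hx ⊢
    rintro _ ⟨I, rfl, hI⟩
    exact I.d_mem x (hx _ ⟨I, rfl, hI⟩)
  st_mem := by
    intro x hx
    simp only [Submodule.mem_sInf] at hx ⊢
    rintro _ ⟨I, rfl, hI⟩
    exact I.st_mem x (hx _ ⟨I, rfl, hI⟩)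

theorem subset_span (S : Set A) {x : A} (hx : x ∈ S) : x ∈ (span S).toIdeal := by
  simp only [span, Submodule.mem_sInf]
  rintro _ ⟨I, rfl, hI⟩
  exact hI hx

/-- The quotient map, as an algebra homomorphism. -/
def proj : A →ₐ[ℂ] A ⧸ I.toIdeal := Ideal.Quotient.mkₐ ℂ I.toIdeal

theorem proj_surjective : Function.Surjective I.proj := Ideal.Quotient.mkₐ_surjective ℂ I.toIdeal

theorem proj_eq_zero {x : A} : I.proj x = 0 ↔ x ∈ I.toIdeal := Ideal.Quotient.eq_zero_iff_mem

/-- The grading of the quotient. -/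
def gr (n : ℕ) : Submodule ℂ (A ⧸ I.toIdeal) := (A.gr n).map I.proj.toLinearMap

theorem proj_mem_gr {n : ℕ} {x : A} (hx : x ∈ A.gr n) : I.proj x ∈ I.gr n := ⟨x, hx, rfl⟩

instance gradedMonoid : SetLike.GradedMonoid I.gr where
  one_mem := ⟨1, A.one_mem, map_one I.proj⟩
  mul_mem := by
    rintro m n _ _ ⟨x, hx, rfl⟩ ⟨y, hy, rfl⟩
    exact ⟨x * y, SetLike.GradedMul.mul_mem hx hy, map_mul I.proj x y⟩

/-- The projection between the homogeneous components of degree `n`. -/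
def projGr (n : ℕ) : A.gr n →ₗ[ℂ] I.gr n where
  toFun x := ⟨I.proj x, I.proj_mem_gr x.2⟩
  map_add' x y := Subtype.ext (map_add I.proj (x : A) y)
  map_smul' c x := Subtype.ext (map_smul I.proj c (x : A))

/-- The homogeneous decomposition of the image of an element in the quotient. -/
def decompA : A →ₐ[ℂ] ⨁ n, I.gr n :=
  (DirectSum.toAlgebra ℂ (fun n => A.gr n)
    (fun n => DirectSum.lof ℂ ℕ (fun n => I.gr n) n ∘ₗ I.projGr n)
    (by
      simp only [LinearMap.comp_apply, DirectSum.lof_eq_of]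
      exact congrArg (DirectSum.of (fun n => I.gr n) 0) (Subtype.ext (map_one I.proj)))
    (by
      intro i j x y
      simp only [LinearMap.comp_apply, DirectSum.lof_eq_of, DirectSum.of_mul_of]
      exact congrArg (DirectSum.of (fun n => I.gr n) (i + j))
        (Subtype.ext (map_mul I.proj (x : A) (y : A))))).comp
    (DirectSum.decomposeAlgEquiv A.gr).toAlgHom

theorem decompA_apply {n : ℕ} {x : A} (hx : x ∈ A.gr n) :
    I.decompA x = DirectSum.of (fun n => I.gr n) n ⟨I.proj x, I.proj_mem_gr hx⟩ := by
  have h : (DirectSum.decomposeAlgEquiv A.gr).toAlgHom x =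
      DirectSum.of (fun n => A.gr n) n (⟨x, hx⟩ : A.gr n) := DirectSum.decompose_of_mem A.gr hx
  rw [decompA, AlgHom.comp_apply, h]
  exact DirectSum.toAddMonoid_of
    (fun n => (DirectSum.lof ℂ ℕ (fun n => I.gr n) n ∘ₗ I.projGr n).toAddMonoidHom) n _

theorem decompA_eq_zero (x : A) (hx : x ∈ I.toIdeal) : I.decompA x = 0 := by
  obtain ⟨N, hN⟩ := sum_proj A.gr x
  rw [hN, map_sum]
  refine Finset.sum_eq_zero fun n _ => ?_
  rw [I.decompA_apply (QPB.proj_mem A.gr n x)]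
  have h0 : (⟨I.proj (A.proj n x), I.proj_mem_gr (QPB.proj_mem A.gr n x)⟩ : I.gr n) = 0 :=
    Subtype.ext (I.proj_eq_zero.2 (I.proj_mem n x hx))
  exact (congrArg (DirectSum.of (fun n => I.gr n) n) h0).trans (map_zero _)

instance graded : GradedAlgebra I.gr :=
  GradedAlgebra.ofAlgHom _ (Ideal.Quotient.liftₐ I.toIdeal I.decompA I.decompA_eq_zero)
    (by
      refine AlgHom.ext fun y => ?_
      obtain ⟨x, rfl⟩ := I.proj_surjective y
      change DirectSum.coeAlgHom I.gr (I.decompA x) = I.proj x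
      refine hom_induction A.gr
        (p := fun x => DirectSum.coeAlgHom I.gr (I.decompA x) = I.proj x) ?_ ?_ x
      · intro n x hx
        rw [I.decompA_apply hx, DirectSum.coeAlgHom_of]
      · intro x y h h'
        simp only [map_add, h, h'])
    (by
      rintro n ⟨_, x, hx, rfl⟩
      exact I.decompA_apply hx)

/-- The differential of the quotient. -/
def dQ : (A ⧸ I.toIdeal) →ₗ[ℂ] A ⧸ I.toIdeal :=
  liftSurj I.proj.toLinearMap I.proj_surjective (I.proj.toLinearMap ∘ₗ A.d)
    (fun x hx => I.proj_eq_zero.2 (I.d_mem x (I.proj_eq_zero.1 hx)))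

/-- The *-structure of the quotient. -/
def stQ : (A ⧸ I.toIdeal) →ₛₗ[starRingEnd ℂ] A ⧸ I.toIdeal :=
  liftSurj I.proj.toLinearMap I.proj_surjective (I.proj.toLinearMap.comp A.st)
    (fun x hx => I.proj_eq_zero.2 (I.st_mem x (I.proj_eq_zero.1 hx)))

theorem dQ_proj (x : A) : I.dQ (I.proj x) = I.proj (A.d x) :=
  liftSurj_apply I.proj.toLinearMap I.proj_surjective (I.proj.toLinearMap ∘ₗ A.d) _ x

theorem stQ_proj (x : A) : I.stQ (I.proj x) = I.proj (A.st x) :=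
  liftSurj_apply I.proj.toLinearMap I.proj_surjective (I.proj.toLinearMap.comp A.st) _ x

/-- The quotient of a graded-differential *-algebra by a graded-differential *-ideal. -/
def quotient : GDSAlg.{u} where
  carrier := A ⧸ I.toIdeal
  gr := I.gr
  d := I.dQ
  st := I.stQ
  d_mem := by
    rintro n _ ⟨x, hx, rfl⟩
    change I.dQ (I.proj x) ∈ I.gr (n + 1)
    rw [dQ_proj]
    exact I.proj_mem_gr (A.d_mem n x hx)
  d_d := by
    intro y
    obtain ⟨x, rfl⟩ := I.proj_surjective y
    rw [dQ_proj, dQ_proj, A.d_d, map_zero]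
  d_mul := by
    rintro n _ ⟨x, hx, rfl⟩ y
    obtain ⟨y, rfl⟩ := I.proj_surjective y
    change I.dQ (I.proj x * I.proj y) =
      I.dQ (I.proj x) * I.proj y + (-1 : ℂ) ^ n • (I.proj x * I.dQ (I.proj y))
    rw [← map_mul, dQ_proj, dQ_proj, dQ_proj, A.d_mul n x hx, map_add, map_smul, map_mul, map_mul]
  st_mem := by
    rintro n _ ⟨x, hx, rfl⟩
    change I.stQ (I.proj x) ∈ I.gr n
    rw [stQ_proj]
    exact I.proj_mem_gr (A.st_mem n x hx)
  st_st := by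
    intro y
    obtain ⟨x, rfl⟩ := I.proj_surjective y
    rw [stQ_proj, stQ_proj, A.st_st]
  st_mul := by
    rintro m n _ ⟨x, hx, rfl⟩ _ ⟨y, hy, rfl⟩
    change I.stQ (I.proj x * I.proj y) =
      (-1 : ℂ) ^ (m * n) • (I.stQ (I.proj y) * I.stQ (I.proj x))
    rw [← map_mul, stQ_proj, stQ_proj, stQ_proj, A.st_mul m n x hx y hy, map_smul, map_mul]
  st_d := by
    intro y
    obtain ⟨x, rfl⟩ := I.proj_surjective y
    rw [dQ_proj, stQ_proj, stQ_proj, dQ_proj, A.st_d]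

end DGIdeal

/-! ### Quantum groups and bicovariant first-order calculi -/

open TensorProduct
open Coalgebra (comul)

/-- The involution as an antilinear map. -/
def starMap (A : Type*) [AddCommGroup A] [StarAddMonoid A] [Module ℂ A] [StarModule ℂ A] :
    A →ₛₗ[starRingEnd ℂ] A := (starLinearEquiv ℂ (A := A)).toLinearMap

/-- A Hopf *-algebra is the algebra of polynomial functions on a compact matrix quantum group if
it is generated, as an algebra, by the matrix entries of a finite-dimensional unitary
corepresentation (a fundamental representation together with its conjugate). -/
class CompactMatrixQuantumGroup (𝒜 : Type u) [Ring 𝒜] [StarRing 𝒜] [HopfAlgebra ℂ 𝒜]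
    [StarModule ℂ 𝒜] : Prop where
  comul_star : ∀ a : 𝒜, comul (R := ℂ) (star a) = star (comul (R := ℂ) a)
  exists_fundamental : ∃ (n : ℕ) (u : Matrix (Fin n) (Fin n) 𝒜),
    u * u.conjTranspose = 1 ∧ u.conjTranspose * u = 1 ∧
    (∀ i j, comul (R := ℂ) (u i j) = ∑ k, u i k ⊗ₜ[ℂ] u k j) ∧
    Algebra.adjoin ℂ {x | ∃ i j, x = u i j} = ⊤

/-- A bicovariant first-order *-calculus `d : 𝒜 → Γ` over a quantum group: a bimodule `Γ` (left and
right multiplications `lact`, `ract`) spanned by the elements `a db`, with a *-structure, such that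
the left and right coactions `coactL : Γ → 𝒜 ⊗ Γ` and `coactR : Γ → Γ ⊗ 𝒜`,
`a db ↦ φ(a) (id ⊗ d)φ(b)` and `a db ↦ φ(a) (d ⊗ id)φ(b)`, are well defined. -/
structure BicovariantCalculus (𝒜 : Type u) [Ring 𝒜] [StarRing 𝒜] [HopfAlgebra ℂ 𝒜]
    [StarModule ℂ 𝒜] where
  carrier : Type u
  [addCommGroup : AddCommGroup carrier]
  [module : Module ℂ carrier]
  lact : 𝒜 →ₐ[ℂ] Module.End ℂ carrier
  ract : 𝒜ᵐᵒᵖ →ₐ[ℂ] Module.End ℂ carrier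
  lact_ract : ∀ a b ξ, lact a (ract b ξ) = ract b (lact a ξ)
  d : 𝒜 →ₗ[ℂ] carrier
  d_mul : ∀ a b, d (a * b) = ract (MulOpposite.op b) (d a) + lact a (d b)
  span_d : Submodule.span ℂ {ξ | ∃ a b, ξ = lact a (d b)} = ⊤
  st : carrier →ₛₗ[starRingEnd ℂ] carrier
  st_st : ∀ ξ, st (st ξ) = ξ
  st_lact : ∀ a ξ, st (lact a ξ) = ract (MulOpposite.op (star a)) (st ξ)
  st_d : ∀ a, st (d a) = d (star a)
  coactL : carrier →ₗ[ℂ] 𝒜 ⊗[ℂ] carrier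
  coactL_apply : ∀ a b, coactL (lact a (d b)) =
    map₂ (LinearMap.mul ℂ 𝒜) lact.toLinearMap (comul a) (map LinearMap.id d (comul b))
  coactR : carrier →ₗ[ℂ] carrier ⊗[ℂ] 𝒜
  coactR_apply : ∀ a b, coactR (lact a (d b)) =
    map₂ lact.toLinearMap (LinearMap.mul ℂ 𝒜) (comul a) (map d LinearMap.id (comul b))

attribute [instance] BicovariantCalculus.addCommGroup BicovariantCalculus.module

section Aux

variable {X A G : Type*} [AddCommGroup X] [Module ℂ X] [AddCommGroup A] [Module ℂ A]
  [AddCommGroup G] [Module ℂ G] (Δ : X →ₗ[ℂ] X ⊗[ℂ] X) (m : X →ₗ[ℂ] A) (g : X →ₗ[ℂ] G)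

theorem coact_aux_left (L : G →ₗ[ℂ] A ⊗[ℂ] G) (hL : ∀ t, L (g t) = map m g (Δ t))
    (x : X ⊗[ℂ] X) : TensorProduct.assoc ℂ A G A (L.rTensor A (map g m x)) =
      map m (map g m) (TensorProduct.assoc ℂ X X X (Δ.rTensor X x)) := by
  induction x using TensorProduct.induction_on with
  | zero => simp
  | add x y h h' => simp only [map_add, h, h']
  | tmul x y =>
    rw [map_tmul, LinearMap.rTensor_tmul, LinearMap.rTensor_tmul, hL]
    generalize Δ x = z
    induction z using TensorProduct.induction_on with
    | zero => simp
    | add x y h h' => simp only [map_add, add_tmul, h, h']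
    | tmul a b => simp

theorem coact_aux_right (R : G →ₗ[ℂ] G ⊗[ℂ] A) (hR : ∀ t, R (g t) = map g m (Δ t))
    (x : X ⊗[ℂ] X) : R.lTensor A (map m g x) = map m (map g m) (Δ.lTensor X x) := by
  induction x using TensorProduct.induction_on with
  | zero => simp
  | add x y h h' => simp only [map_add, h, h']
  | tmul x y => simp only [map_tmul, LinearMap.lTensor_tmul, hR]

end Aux

namespace BicovariantCalculus

variable {𝒜 : Type u} [Ring 𝒜] [StarRing 𝒜] [HopfAlgebra ℂ 𝒜] [StarModule ℂ 𝒜]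
  (Γ : BicovariantCalculus 𝒜)

/-- The map `a ⊗ b ↦ a db`. -/
def adb : 𝒜 ⊗[ℂ] 𝒜 →ₗ[ℂ] Γ.carrier :=
  lift ((Γ.lact.toLinearMap : 𝒜 →ₗ[ℂ] Γ.carrier →ₗ[ℂ] Γ.carrier).compl₂ Γ.d)

@[simp] theorem adb_tmul (a b : 𝒜) : Γ.adb (a ⊗ₜ b) = Γ.lact a (Γ.d b) := rfl

theorem adb_surjective : Function.Surjective Γ.adb := by
  rw [← LinearMap.range_eq_top, eq_top_iff, ← Γ.span_d, Submodule.span_le]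
  rintro _ ⟨a, b, rfl⟩
  exact ⟨a ⊗ₜ b, rfl⟩

theorem coactL_comp : Γ.coactL ∘ₗ Γ.adb = map (LinearMap.mul' ℂ 𝒜) Γ.adb ∘ₗ comul := by
  ext a b
  simp only [AlgebraTensorModule.curry_apply, LinearMap.restrictScalars_self, curry_apply,
    LinearMap.comp_apply, adb_tmul, coactL_apply, TensorProduct.comul_tmul]
  generalize (comul (R := ℂ) a) = x
  generalize (comul (R := ℂ) b) = y
  induction x using TensorProduct.induction_on with
  | zero => simp
  | add x x' h h' => simp only [map_add, LinearMap.add_apply, add_tmul, h, h']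
  | tmul a a' =>
    induction y using TensorProduct.induction_on with
    | zero => simp
    | add x x' h h' => simp only [map_add, tmul_add, h, h']
    | tmul b b' => simp

theorem coactR_comp : Γ.coactR ∘ₗ Γ.adb = map Γ.adb (LinearMap.mul' ℂ 𝒜) ∘ₗ comul := by
  ext a b
  simp only [AlgebraTensorModule.curry_apply, LinearMap.restrictScalars_self, curry_apply,
    LinearMap.comp_apply, adb_tmul, coactR_apply, TensorProduct.comul_tmul]
  generalize (comul (R := ℂ) a) = x
  generalize (comul (R := ℂ) b) = y
  induction x using TensorProduct.induction_on with
  | zero => simp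
  | add x x' h h' => simp only [map_add, LinearMap.add_apply, add_tmul, h, h']
  | tmul a a' =>
    induction y using TensorProduct.induction_on with
    | zero => simp
    | add x x' h h' => simp only [map_add, tmul_add, h, h']
    | tmul b b' => simp

/-- The left and right coactions commute. -/
theorem coact_comm (ξ : Γ.carrier) :
    TensorProduct.assoc ℂ 𝒜 Γ.carrier 𝒜 (Γ.coactL.rTensor 𝒜 (Γ.coactR ξ)) =
      Γ.coactR.lTensor 𝒜 (Γ.coactL ξ) := by
  obtain ⟨t, rfl⟩ := Γ.adb_surjective ξ
  have hL := fun t => LinearMap.congr_fun Γ.coactL_comp t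
  have hR := fun t => LinearMap.congr_fun Γ.coactR_comp t
  simp only [LinearMap.comp_apply] at hL hR
  rw [hL, hR, coact_aux_left _ _ _ _ hL, coact_aux_right _ _ _ _ hR]
  exact congrArg _ (Coalgebra.coassoc_apply t)

/-- The space of left-invariant elements of `Γ`. -/
def inv : Submodule ℂ Γ.carrier :=
  LinearMap.ker (Γ.coactL - TensorProduct.mk ℂ 𝒜 Γ.carrier 1)

theorem mem_inv {ξ : Γ.carrier} : ξ ∈ Γ.inv ↔ Γ.coactL ξ = 1 ⊗ₜ ξ := by
  simp [inv, sub_eq_zero]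

theorem coactR_mem (ξ : Γ.inv) : Γ.coactR ξ ∈ LinearMap.range (Γ.inv.subtype.rTensor 𝒜) := by
  have hex : Function.Exact Γ.inv.subtype
      (Γ.coactL - TensorProduct.mk ℂ 𝒜 Γ.carrier 1) := LinearMap.exact_subtype_ker_map _
  have := Module.Flat.rTensor_exact 𝒜 hex
  refine (this _).1 ?_
  have h := Γ.coact_comm ξ
  rw [Γ.mem_inv.1 ξ.2] at h
  rw [LinearMap.rTensor_sub]
  change Γ.coactL.rTensor 𝒜 _ - (TensorProduct.mk ℂ 𝒜 Γ.carrier 1).rTensor 𝒜 _ = 0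
  rw [sub_eq_zero]
  apply (TensorProduct.assoc ℂ 𝒜 Γ.carrier 𝒜).injective
  rw [h, LinearMap.lTensor_tmul]
  generalize Γ.coactR ξ = t
  induction t using TensorProduct.induction_on with
  | zero => simp
  | add x y h h' => simp only [map_add, tmul_add, h, h']
  | tmul x y => simp

/-- The adjoint action `ϖ : Γ_inv → Γ_inv ⊗ 𝒜`, the restriction of the right coaction. -/
def adj : Γ.inv →ₗ[ℂ] Γ.inv ⊗[ℂ] 𝒜 :=
  LinearMap.codRestrictOfInjective (Γ.coactR ∘ₗ Γ.inv.subtype) (Γ.inv.subtype.rTensor 𝒜)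
    (Module.Flat.rTensor_preserves_injective_linearMap _ Γ.inv.injective_subtype)
    (fun ξ => Γ.coactR_mem ξ)

theorem adj_spec (ξ : Γ.inv) : Γ.inv.subtype.rTensor 𝒜 (Γ.adj ξ) = Γ.coactR ξ :=
  LinearMap.codRestrictOfInjective_comp_apply _ _ _ _ ξ

section Star

theorem map_st_act (x : 𝒜 ⊗[ℂ] 𝒜) (y : 𝒜 ⊗[ℂ] 𝒜) :
    map (starMap 𝒜) Γ.st
      (map₂ (LinearMap.mul ℂ 𝒜) Γ.lact.toLinearMap x (map LinearMap.id Γ.d y)) =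
    map LinearMap.id Γ.d (star y * star x) -
      map₂ (LinearMap.mul ℂ 𝒜) Γ.lact.toLinearMap (star y) (map LinearMap.id Γ.d (star x)) := by
  induction x using TensorProduct.induction_on with
  | zero => simp
  | add x x' h h' =>
    simp only [map_add, LinearMap.add_apply, star_add, mul_add, h, h']; abel
  | tmul a a' =>
    induction y using TensorProduct.induction_on with
    | zero => simp
    | add x x' h h' =>
      simp only [map_add, LinearMap.add_apply, star_add, add_mul, h, h']; abel
    | tmul b b' =>
      simp [starMap, Γ.st_lact, Γ.st_d, Γ.d_mul, ← tmul_sub]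

variable [CompactMatrixQuantumGroup 𝒜]

theorem coactL_st (ξ : Γ.carrier) : Γ.coactL (Γ.st ξ) = map (starMap 𝒜) Γ.st (Γ.coactL ξ) := by
  obtain ⟨t, rfl⟩ := Γ.adb_surjective ξ
  induction t using TensorProduct.induction_on with
  | zero => simp
  | add x y h h' => simp only [map_add, h, h']
  | tmul a b =>
    have hd : ∀ c, Γ.coactL (Γ.d c) = map LinearMap.id Γ.d (comul c) := by
      intro c
      have := Γ.coactL_apply 1 c
      rw [map_one] at this
      refine this.trans ?_
      rw [Bialgebra.comul_one]
      generalize comul (R := ℂ) c = t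
      induction t using TensorProduct.induction_on with
      | zero => simp
      | add x y h h' => simp only [map_add, h, h']
      | tmul x y => simp [Algebra.TensorProduct.one_def]
    have h1 : Γ.st (Γ.adb (a ⊗ₜ b)) = Γ.d (star b * star a) - Γ.lact (star b) (Γ.d (star a)) := by
      rw [adb_tmul, Γ.st_lact, Γ.st_d, Γ.d_mul]; abel
    rw [h1, map_sub, hd, Γ.coactL_apply, adb_tmul, Γ.coactL_apply, map_st_act,
      Bialgebra.comul_mul, CompactMatrixQuantumGroup.comul_star,
      CompactMatrixQuantumGroup.comul_star]

/-- The *-structure of `Γ_inv`. -/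
def invSt : Γ.inv →ₛₗ[starRingEnd ℂ] Γ.inv where
  toFun ξ := ⟨Γ.st ξ, by
    rw [Γ.mem_inv, Γ.coactL_st, Γ.mem_inv.1 ξ.2, map_tmul]
    simp [starMap]⟩
  map_add' ξ η := Subtype.ext (by simp)
  map_smul' c ξ := Subtype.ext (by simp)

theorem invSt_invSt (ξ : Γ.inv) : Γ.invSt (Γ.invSt ξ) = ξ := Subtype.ext (Γ.st_st ξ)

end Star

/-! ### The universal envelope of `Γ` -/

/-- The free graded-differential *-algebra on the space `𝒜` in degree `0`. -/
def preEnvelope (𝒜 : Type u) [Ring 𝒜] [StarRing 𝒜] [HopfAlgebra ℂ 𝒜] [StarModule ℂ 𝒜] :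
    GDSAlg.{u} :=
  free 𝒜 (starMap 𝒜) (fun a => star_star a) 0

/-- The inclusion of generators `a`. -/
def preInl : 𝒜 →ₗ[ℂ] preEnvelope 𝒜 := TensorAlgebra.ι ℂ ∘ₗ LinearMap.inl ℂ 𝒜 𝒜

/-- The map `a ⊗ b ↦ a db` into the free graded-differential *-algebra. -/
def preAdb : 𝒜 ⊗[ℂ] 𝒜 →ₗ[ℂ] preEnvelope 𝒜 :=
  lift ((LinearMap.mul ℂ (preEnvelope 𝒜)).compl₁₂ preInl ((preEnvelope 𝒜).d ∘ₗ preInl))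

/-- The defining relations of the universal envelope of `Γ`: those of the algebra `𝒜`, and
`∑ aₖ dbₖ = 0` whenever this holds in `Γ`. -/
def relations : Set (preEnvelope 𝒜) :=
  {x | x = preInl 1 - 1 ∨ (∃ a b : 𝒜, x = preInl a * preInl b - preInl (a * b)) ∨
    ∃ t, Γ.adb t = 0 ∧ x = preAdb t}

/-- The universal differential envelope `Γ^∧` of the first-order calculus `Γ`. Since the ideal of
relations is closed under `d`, the relation `∑ aₖ dbₖ = 0` entails `∑ daₖ dbₖ = 0`. -/
def envelope : GDSAlg.{u} := (DGIdeal.span Γ.relations).quotient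

/-- The inclusion of `𝒜` into `Γ^∧`. -/
def envIncl : 𝒜 →ₐ[ℂ] Γ.envelope :=
  AlgHom.ofLinearMap ((DGIdeal.span Γ.relations).proj.toLinearMap ∘ₗ preInl)
    (by
      have := (DGIdeal.span Γ.relations).proj_eq_zero.2
        (DGIdeal.subset_span Γ.relations (Or.inl rfl))
      rw [map_sub, sub_eq_zero] at this
      exact this.trans (map_one _))
    (by
      intro a b
      have := (DGIdeal.span Γ.relations).proj_eq_zero.2
        (DGIdeal.subset_span Γ.relations (Or.inr (Or.inl ⟨a, b, rfl⟩)))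
      rw [map_sub, sub_eq_zero, map_mul] at this
      exact this.symm)

/-- The inclusion of `Γ` into `Γ^∧`. -/
def envInclΓ : Γ.carrier →ₗ[ℂ] Γ.envelope :=
  liftSurj Γ.adb Γ.adb_surjective ((DGIdeal.span Γ.relations).proj.toLinearMap ∘ₗ preAdb)
    (fun t ht => (DGIdeal.span Γ.relations).proj_eq_zero.2
      (DGIdeal.subset_span Γ.relations (Or.inr (Or.inr ⟨t, ht, rfl⟩))))

theorem envInclΓ_lact (a b : 𝒜) :
    Γ.envInclΓ (Γ.lact a (Γ.d b)) = Γ.envIncl a * Γ.envelope.d (Γ.envIncl b) := by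
  have h := liftSurj_apply Γ.adb Γ.adb_surjective
    ((DGIdeal.span Γ.relations).proj.toLinearMap ∘ₗ preAdb)
    (fun t ht => (DGIdeal.span Γ.relations).proj_eq_zero.2
      (DGIdeal.subset_span Γ.relations (Or.inr (Or.inr ⟨t, ht, rfl⟩)))) (a ⊗ₜ b)
  refine h.trans ?_
  change (DGIdeal.span Γ.relations).proj (preInl a * (preEnvelope 𝒜).d (preInl b)) = _
  rw [map_mul, ← DGIdeal.dQ_proj]
  rfl

end BicovariantCalculus

namespace BicovariantCalculus

variable {𝒜 : Type u} [Ring 𝒜] [StarRing 𝒜] [HopfAlgebra ℂ 𝒜] [StarModule ℂ 𝒜]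
  (Γ : BicovariantCalculus 𝒜)

theorem preInl_mem (a : 𝒜) : preInl a ∈ (preEnvelope 𝒜).gr 0 := Free.gen_mem 0 (Sum.inl a)

theorem envIncl_mem (a : 𝒜) : Γ.envIncl a ∈ Γ.envelope.gr 0 :=
  (DGIdeal.span Γ.relations).proj_mem_gr (preInl_mem a)

theorem envInclΓ_mem (ξ : Γ.carrier) : Γ.envInclΓ ξ ∈ Γ.envelope.gr 1 := by
  obtain ⟨t, rfl⟩ := Γ.adb_surjective ξ
  induction t using TensorProduct.induction_on with
  | zero =>
    rw [LinearMap.map_zero, LinearMap.map_zero]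
    exact (Γ.envelope.gr 1).zero_mem
  | add x y h h' =>
    rw [LinearMap.map_add, LinearMap.map_add]
    exact (Γ.envelope.gr 1).add_mem h h'
  | tmul a b =>
    rw [adb_tmul, envInclΓ_lact]
    exact SetLike.GradedMul.mul_mem (A := Γ.envelope.gr) (i := 0) (j := 1) (Γ.envIncl_mem a)
      (Γ.envelope.d_mem 0 _ (Γ.envIncl_mem b))

end BicovariantCalculus

/-- A higher-order calculus on the quantum group extending the first-order calculus `Γ`: a
graded-differential *-algebra obtained from the universal envelope `Γ^∧` by factorizing through
a graded-differential *-ideal (the kernel of `proj`) which vanishes in degrees `0` and `1`. The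
two extreme cases are the envelope `Γ^∧` itself, and the braided exterior algebra `Γ^∨`. -/
structure HigherOrderCalculus {𝒜 : Type u} [Ring 𝒜] [StarRing 𝒜] [HopfAlgebra ℂ 𝒜]
    [StarModule ℂ 𝒜] (Γ : BicovariantCalculus 𝒜) where
  alg : GDSAlg.{u}
  proj : DGHom Γ.envelope alg
  proj_mem : ∀ n, ∀ x ∈ Γ.envelope.gr n, proj x ∈ alg.gr n
  proj_st : ∀ x, proj (Γ.envelope.st x) = alg.st (proj x)
  proj_surjective : Function.Surjective proj
  proj_injective : ∀ n ≤ 1, ∀ x ∈ Γ.envelope.gr n, proj x = 0 → x = 0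

namespace HigherOrderCalculus

variable {𝒜 : Type u} [Ring 𝒜] [StarRing 𝒜] [HopfAlgebra ℂ 𝒜] [StarModule ℂ 𝒜]
  {Γ : BicovariantCalculus 𝒜}

/-- The calculus described by the universal envelope `Γ^∧`. -/
def universal (Γ : BicovariantCalculus 𝒜) : HigherOrderCalculus Γ where
  alg := Γ.envelope
  proj := ⟨AlgHom.id ℂ _, fun _ => rfl⟩
  proj_mem _ _ h := h
  proj_st _ := rfl
  proj_surjective := Function.surjective_id
  proj_injective _ _ _ _ h := h

variable (C : HigherOrderCalculus Γ)

/-- The inclusion of `𝒜` as the component of degree zero. -/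
def incl : 𝒜 →ₐ[ℂ] C.alg := C.proj.toAlgHom.comp Γ.envIncl

/-- The inclusion of `Γ` as the component of degree one. -/
def inclΓ : Γ.carrier →ₗ[ℂ] C.alg := C.proj.toAlgHom.toLinearMap ∘ₗ Γ.envInclΓ

theorem incl_mem (a : 𝒜) : C.incl a ∈ C.alg.gr 0 := C.proj_mem 0 _ (Γ.envIncl_mem a)

theorem inclΓ_mem (ξ : Γ.carrier) : C.inclΓ ξ ∈ C.alg.gr 1 := C.proj_mem 1 _ (Γ.envInclΓ_mem ξ)

end HigherOrderCalculus

/-! ### The universal algebra `Ω` -/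

section Universal

variable {𝒜 : Type u} [Ring 𝒜] [StarRing 𝒜] [HopfAlgebra ℂ 𝒜] [StarModule ℂ 𝒜]
  [CompactMatrixQuantumGroup 𝒜]

/-- The algebra `Ω`, the universal differential envelope of the tensor algebra of `Γ_inv`: the
differential algebra freely generated by the space `Γ_inv` in degree one. -/
def Omega (Γ : BicovariantCalculus 𝒜) : GDSAlg.{u} := free Γ.inv Γ.invSt Γ.invSt_invSt 1

/-- The inclusion of `Γ_inv` into `Ω`. -/
def omegaIncl (Γ : BicovariantCalculus 𝒜) : Γ.inv →ₗ[ℂ] Omega Γ :=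
  TensorAlgebra.ι ℂ ∘ₗ LinearMap.inl ℂ Γ.inv Γ.inv

variable {Γ : BicovariantCalculus 𝒜} (C : HigherOrderCalculus Γ)

variable (Γ) in
/-- The generators `ϑ` and `dϑ` of `Ω`. -/
def omegaGen (g : Γ.inv ⊕ Γ.inv) : Omega Γ := Free.gen g

variable (Γ) in
theorem omegaGen_mem (g : Γ.inv ⊕ Γ.inv) : omegaGen Γ g ∈ (Omega Γ).gr (Free.wt 1 g) :=
  Free.gen_mem 1 g

variable (Γ) in
theorem omega_d_inl (v : Γ.inv) : (Omega Γ).d (omegaGen Γ (Sum.inl v)) = omegaGen Γ (Sum.inr v) :=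
  Free.d_inl 1 v

variable (Γ) in
theorem omega_d_inr (v : Γ.inv) : (Omega Γ).d (omegaGen Γ (Sum.inr v)) = 0 := Free.d_inr 1 v

theorem omega_gr_induction {p : ℕ → Omega Γ → Prop} (h0 : ∀ n, p n 0) (h1 : p 0 1)
    (hgen : ∀ g n x, p n x → p (Free.wt 1 g + n) (omegaGen Γ g * x))
    (hadd : ∀ n x y, p n x → p n y → p n (x + y))
    (hsmul : ∀ n (c : ℂ) x, p n x → p n (c • x)) (n : ℕ) (x : Omega Γ)
    (hx : x ∈ (Omega Γ).gr n) : p n x := by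
  refine Submodule.span_induction (p := fun x _ => p n x) ?_ (h0 n)
    (fun x y _ _ => hadd n x y) (fun c x _ => hsmul n c x) hx
  clear hx
  rintro _ ⟨l, rfl, rfl⟩
  induction l with
  | nil => exact h1
  | cons g l ih =>
    have h := hgen g _ _ ih
    simp only [List.map_cons, List.prod_cons, List.sum_cons]
    exact h

theorem omega_induction {p : Omega Γ → Prop} (h0 : p 0) (h1 : p 1)
    (hgen : ∀ g x, p x → p (omegaGen Γ g * x)) (hadd : ∀ x y, p x → p y → p (x + y))
    (hsmul : ∀ (c : ℂ) x, p x → p (c • x)) (x : Omega Γ) : p x :=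
  hom_induction (Omega Γ).gr (fun n x hx => omega_gr_induction (p := fun _ => p) (fun _ => h0) h1
    (fun g _ => hgen g) (fun _ => hadd) (fun _ => hsmul) n x hx) hadd x

/-- The element `ϖ(ϑ) + 1 ⊗ ϑ` of the graded tensor product of `Ω` and the calculus on `G`. -/
def adjGen : Γ.inv →ₗ[ℂ] (Omega Γ).gr ᵍ⊗[ℂ] C.alg.gr :=
  (GradedTensorProduct.of ℂ (Omega Γ).gr C.alg.gr).toLinearMap ∘ₗ
    (map (omegaIncl Γ) C.incl.toLinearMap ∘ₗ Γ.adj +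
      TensorProduct.mk ℂ (Omega Γ) C.alg 1 ∘ₗ C.inclΓ ∘ₗ Γ.inv.subtype)

/-- The algebra homomorphism with `ϑ ↦ ϖ(ϑ) + 1 ⊗ ϑ` and `dϑ ↦ d(ϖ(ϑ) + 1 ⊗ ϑ)`. -/
def adjTildeHom : Omega Γ →ₐ[ℂ] (Omega Γ).gr ᵍ⊗[ℂ] C.alg.gr :=
  TensorAlgebra.lift ℂ
    (LinearMap.coprod (adjGen C) (GDSAlg.tensorD (Omega Γ) C.alg ∘ₗ adjGen C))

theorem adjTildeHom_inl (v : Γ.inv) :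
    adjTildeHom C (omegaGen Γ (Sum.inl v)) = adjGen C v := by
  refine (TensorAlgebra.lift_ι_apply _ _).trans ?_
  simp

theorem adjTildeHom_inr (v : Γ.inv) :
    adjTildeHom C (omegaGen Γ (Sum.inr v)) = GDSAlg.tensorD (Omega Γ) C.alg (adjGen C v) := by
  refine (TensorAlgebra.lift_ι_apply _ _).trans ?_
  simp

theorem adjGen_mem (v : Γ.inv) : adjGen C v ∈ GDSAlg.tensorGr (Omega Γ) C.alg 1 := by
  have h1 : ∀ t : Γ.inv ⊗[ℂ] 𝒜, GradedTensorProduct.of ℂ (Omega Γ).gr C.alg.gr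
      (map (omegaIncl Γ) C.incl.toLinearMap t) ∈ GDSAlg.tensorGr (Omega Γ) C.alg 1 := by
    intro t
    induction t using TensorProduct.induction_on with
    | zero => simp
    | add x y h h' => rw [map_add, map_add]; exact add_mem h h'
    | tmul x y =>
      exact GDSAlg.tmul_mem (i := 1) (j := 0) (Free.gen_mem 1 (Sum.inl x)) (C.incl_mem y)
  have h2 : (1 : Omega Γ) ᵍ⊗ₜ[ℂ] (C.inclΓ v) ∈ GDSAlg.tensorGr (Omega Γ) C.alg 1 :=
    GDSAlg.tmul_mem (i := 0) (j := 1) (Omega Γ).one_mem (C.inclΓ_mem v)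
  exact add_mem (h1 _) h2

theorem adjTildeHom_gen_mem (g : Γ.inv ⊕ Γ.inv) :
    adjTildeHom C (omegaGen Γ g) ∈ GDSAlg.tensorGr (Omega Γ) C.alg (Free.wt 1 g) := by
  rcases g with v | v
  · rw [adjTildeHom_inl]; exact adjGen_mem C v
  · rw [adjTildeHom_inr]; exact GDSAlg.tensorD_mem (adjGen_mem C v)

theorem adjTildeHom_mem (n : ℕ) (x : Omega Γ) (hx : x ∈ (Omega Γ).gr n) :
    adjTildeHom C x ∈ GDSAlg.tensorGr (Omega Γ) C.alg n := by
  refine omega_gr_induction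
    (p := fun n x => adjTildeHom C x ∈ GDSAlg.tensorGr (Omega Γ) C.alg n) ?_ ?_ ?_ ?_ ?_ n x hx
  · intro n; rw [map_zero]; exact zero_mem _
  · rw [map_one]
    exact GDSAlg.tmul_mem (i := 0) (j := 0) (Omega Γ).one_mem C.alg.one_mem
  · intro g n x h
    rw [map_mul]
    exact GDSAlg.tensorGr_mul (adjTildeHom_gen_mem C g) h
  · intro n x y h h'; rw [map_add]; exact add_mem h h'
  · intro n c x h; rw [map_smul]; exact Submodule.smul_mem _ _ h

theorem adjTildeHom_d (x : Omega Γ) :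
    adjTildeHom C ((Omega Γ).d x) = GDSAlg.tensorD (Omega Γ) C.alg (adjTildeHom C x) := by
  refine omega_induction
    (p := fun x => adjTildeHom C ((Omega Γ).d x) = GDSAlg.tensorD _ _ (adjTildeHom C x))
    ?_ ?_ ?_ ?_ ?_ x
  · simp only [map_zero]
  · have h : adjTildeHom C 1 = (1 : Omega Γ) ᵍ⊗ₜ[ℂ] (1 : C.alg) := map_one _
    rw [h, (Omega Γ).d_one, GDSAlg.tensorD_tmul, (Omega Γ).d_one, C.alg.d_one, map_zero]
    simp [GradedTensorProduct.tmul]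
  · intro g x h
    have hg : adjTildeHom C ((Omega Γ).d (omegaGen Γ g)) =
        GDSAlg.tensorD _ _ (adjTildeHom C (omegaGen Γ g)) := by
      rcases g with v | v
      · rw [adjTildeHom_inl, ← adjTildeHom_inr, omega_d_inl]
      · rw [adjTildeHom_inr, GDSAlg.tensorD_tensorD, omega_d_inr, map_zero]
    rw [(Omega Γ).d_mul _ _ (omegaGen_mem Γ g) x, map_add, map_mul, map_smul, map_mul, map_mul,
      h, hg, GDSAlg.tensorD_mul (adjTildeHom_gen_mem C g) (adjTildeHom C x)]
  · intro x y h h'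
    simp only [map_add, h, h']
  · intro c x h
    simp only [map_smul, h]

/-- The coaction `ϖ~ : Ω → Ω ⊗̂ Γ^⋆`, the graded-differential homomorphism with
`ϖ~(ϑ) = ϖ(ϑ) + 1 ⊗ ϑ` for `ϑ ∈ Γ_inv`. -/
def adjTilde : DGCoaction (Omega Γ) C.alg where
  toAlgHom := adjTildeHom C
  map_mem := adjTildeHom_mem C
  map_d := adjTildeHom_d C

/-- The graded-differential subalgebra `ℸ` of `ϖ~`-invariant elements of `Ω`. -/
def daleth : DGSub (Omega Γ) := (adjTilde C).invariants

end Universal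

/-! ### Quantum principal bundles -/

/-- A quantum principal bundle `P = (ℬ, i, F)` over the quantum space represented by `𝒱`. -/
structure QuantumPrincipalBundle (𝒜 : Type u) [Ring 𝒜] [StarRing 𝒜] [HopfAlgebra ℂ 𝒜]
    [StarModule ℂ 𝒜] (𝒱 : Type v) [Ring 𝒱] [StarRing 𝒱] [Algebra ℂ 𝒱] [StarModule ℂ 𝒱]
    (ℬ : Type w) [Ring ℬ] [StarRing ℬ] [Algebra ℂ ℬ] [StarModule ℂ ℬ] where
  i : 𝒱 →⋆ₐ[ℂ] ℬ
  F : ℬ →ₐ[ℂ] ℬ ⊗[ℂ] 𝒜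
  F_star : ∀ b, F (star b) = star (F b)
  coassoc : ∀ b, TensorProduct.assoc ℂ ℬ 𝒜 𝒜 (F.toLinearMap.rTensor 𝒜 (F b)) =
    (comul (R := ℂ) (A := 𝒜)).lTensor ℬ (F b)
  counit : ∀ b, (Coalgebra.counit (R := ℂ) (A := 𝒜)).lTensor ℬ (F b) = b ⊗ₜ 1
  i_injective : Function.Injective i
  range_i : ∀ b, b ∈ Set.range i ↔ F b = b ⊗ₜ 1
  free : ∀ a : 𝒜, (1 : ℬ) ⊗ₜ[ℂ] a ∈
    Submodule.span ℂ {t : ℬ ⊗[ℂ] 𝒜 | ∃ q b : ℬ, t = (q ⊗ₜ 1) * F b}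

section Bundle

variable {𝒜 : Type u} [Ring 𝒜] [StarRing 𝒜] [HopfAlgebra ℂ 𝒜] [StarModule ℂ 𝒜]
  {𝒱 : Type v} [Ring 𝒱] [StarRing 𝒱] [Algebra ℂ 𝒱] [StarModule ℂ 𝒱]
  {ℬ : Type w} [Ring ℬ] [StarRing ℬ] [Algebra ℂ ℬ] [StarModule ℂ ℬ]
  {Γ : BicovariantCalculus 𝒜}

/-- A calculus `Ω(P)` on a quantum principal bundle `P`: a graded-differential *-algebra with
`Ω⁰(P) = ℬ`, generated by `ℬ` as a differential algebra, such that the right action `F` extends to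
a graded-differential *-homomorphism `F^ : Ω(P) → Ω(P) ⊗̂ Γ^⋆`. -/
structure BundleCalculus (P : QuantumPrincipalBundle 𝒜 𝒱 ℬ) (C : HigherOrderCalculus Γ) where
  Ω : GDSAlg.{w}
  incl : ℬ →ₐ[ℂ] Ω
  incl_star : ∀ b, incl (star b) = Ω.st (incl b)
  incl_injective : Function.Injective incl
  range_incl : ∀ x, x ∈ Set.range incl ↔ x ∈ Ω.gr 0
  generates : Algebra.adjoin ℂ (Set.range incl ∪ Set.range (fun b => Ω.d (incl b))) = ⊤
  Fhat : DGCoaction Ω C.alg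
  Fhat_incl : ∀ b, Fhat (incl b) =
    GradedTensorProduct.of ℂ Ω.gr C.alg.gr (map incl.toLinearMap C.incl.toLinearMap (P.F b))
  Fhat_st : ∀ x, Fhat (Ω.st x) = GDSAlg.tensorSt Ω C.alg (Fhat x)

variable {P : QuantumPrincipalBundle 𝒜 𝒱 ℬ} {C : HigherOrderCalculus Γ}

/-- The algebra `Ω(M)` of differential forms on the base: the `F^`-invariant forms on the bundle. -/
def BundleCalculus.baseForms (Q : BundleCalculus P C) : DGSub Q.Ω := Q.Fhat.invariants

/-- A connection: a hermitian map `ω : Γ_inv → Ω¹(P)` with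
`F^ ω(ϑ) = (ω ⊗ id)ϖ(ϑ) + 1 ⊗ ϑ`. -/
structure Connection [CompactMatrixQuantumGroup 𝒜] (Q : BundleCalculus P C) where
  form : Γ.inv →ₗ[ℂ] Q.Ω
  form_mem : ∀ ϑ, form ϑ ∈ Q.Ω.gr 1
  form_st : ∀ ϑ, form (Γ.invSt ϑ) = Q.Ω.st (form ϑ)
  Fhat_form : ∀ ϑ : Γ.inv, Q.Fhat (form ϑ) =
    GradedTensorProduct.of ℂ Q.Ω.gr C.alg.gr (map form C.incl.toLinearMap (Γ.adj ϑ)) +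
      (1 : Q.Ω) ᵍ⊗ₜ[ℂ] C.inclΓ ϑ

/-- The homomorphism `f : Ω → Ω(P)` of differential algebras extends the connection `ω`. -/
def Connection.ExtendsTo [CompactMatrixQuantumGroup 𝒜] {Q : BundleCalculus P C}
    (ω : Connection Q) (f : DGHom (Omega Γ) Q.Ω) : Prop :=
  ∀ ϑ, f (omegaIncl Γ ϑ) = ω.form ϑ

/-- The linear map `L : Ω → Ω(P)` is given by `L(1) = 0`, `L(ϑ) = 0`, `L(dϑ) = ω(ϑ) - τ(ϑ)` and
`L(wu) = L(w) g(u) + (-1)^∂w f(w) L(u)`, where `f` and `g` are the extensions of `ω` and `τ`. -/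
structure IsHomotopy [CompactMatrixQuantumGroup 𝒜] {Q : BundleCalculus P C} (ω τ : Connection Q)
    (f g : DGHom (Omega Γ) Q.Ω) (L : Omega Γ →ₗ[ℂ] Q.Ω) : Prop where
  map_one : L 1 = 0
  map_incl : ∀ ϑ, L (omegaIncl Γ ϑ) = 0
  map_d_incl : ∀ ϑ, L ((Omega Γ).d (omegaIncl Γ ϑ)) = ω.form ϑ - τ.form ϑ
  map_mul : ∀ n, ∀ w ∈ (Omega Γ).gr n, ∀ u,
    L (w * u) = L w * g u + (-1 : ℂ) ^ n • (f w * L u)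

end Bundle

end QPB

end

open QPB

/-!
Homomorphisms of differential algebras and skew derivations along homomorphisms are determined by
their values on differential generators, and on the free algebra `Ω` these values can be prescribed.
So every identity here is checked on `ϑ` and `dϑ` only. The extension `ω̂` is hermitian because
`* ω̂ *` extends `ω` too, and it is covariant because both sides of the covariance identity are
homomorphisms of differential algebras with the same value on `ϑ`.

The homotopy `L` is a skew derivation along `ω̂ ∘ parity` and `τ̂`, that is, the upper right
corner of a homomorphism into triangular matrices. Both `ω̂ - τ̂` and `L d + d L` are skew
derivations along `ω̂` and `τ̂`, which gives the homotopy formula. The inhomogeneous terms `1 ⊗ ϑ`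
cancel in the covariance identity for `L` on `dϑ`, which reduces to the homotopy formula tensored
with `Γ^⋆`. As `L` preserves invariants, `ω̂` and `τ̂` induce the same map in cohomology.
-/

noncomputable section

namespace QPB

open TensorProduct

section SkewDerivation

variable {R : Type*} [CommRing R] {A B : Type*} [Ring A] [Algebra R A] [Ring B] [Algebra R B]

/-- `D` is a skew derivation along the homomorphisms `σ` (acting on the left factor) and `τ` (acting
on the right factor). A derivation in the usual sense is the case `σ = τ = id`, a differential the
case where `σ` is the parity automorphism and `τ = id`. -/
def IsSkewDerivation (σ τ : A →ₐ[R] B) (D : A →ₗ[R] B) : Prop :=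
  ∀ x y, D (x * y) = D x * τ y + σ x * D y

namespace IsSkewDerivation

variable {σ τ : A →ₐ[R] B} {D D' : A →ₗ[R] B}

theorem map_one (hD : IsSkewDerivation σ τ D) : D 1 = 0 := by
  simpa only [mul_one, one_mul, _root_.map_one, left_eq_add] using hD 1 1

theorem ext_of_adjoin_eq_top (hD : IsSkewDerivation σ τ D) (hD' : IsSkewDerivation σ τ D')
    {G : Set A} (hG : Algebra.adjoin R G = ⊤) (h : ∀ x ∈ G, D x = D' x) : D = D' := by
  ext x
  induction (hG ▸ Algebra.mem_top : x ∈ Algebra.adjoin R G) using Algebra.adjoin_induction with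
  | mem x hx => exact h x hx
  | algebraMap r => simp only [Algebra.algebraMap_eq_smul_one, map_smul, hD.map_one, hD'.map_one]
  | add x y _ _ hx hy => rw [map_add, map_add, hx, hy]
  | mul x y _ _ hx hy => rw [hD, hD', hx, hy]

theorem neg (hD : IsSkewDerivation σ τ D) : IsSkewDerivation σ τ (-D) := fun x y => by
  simp only [LinearMap.neg_apply, hD x y, neg_add, neg_mul, mul_neg]

theorem sub_algHom (σ τ : A →ₐ[R] B) :
    IsSkewDerivation σ τ (σ.toLinearMap - τ.toLinearMap) := fun x y => by
  simp only [LinearMap.sub_apply, AlgHom.toLinearMap_apply, map_mul, sub_mul, mul_sub,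
    sub_add_sub_cancel']

theorem algHom_comp {B' : Type*} [Ring B'] [Algebra R B'] (ρ : B →ₐ[R] B')
    (hD : IsSkewDerivation σ τ D) :
    IsSkewDerivation (ρ.comp σ) (ρ.comp τ) (ρ.toLinearMap ∘ₗ D) := fun x y => by
  simp only [LinearMap.comp_apply, AlgHom.toLinearMap_apply, AlgHom.comp_apply, hD x y, map_add,
    map_mul]

theorem comp_algHom {A' : Type*} [Ring A'] [Algebra R A'] (ρ : A' →ₐ[R] A)
    (hD : IsSkewDerivation σ τ D) :
    IsSkewDerivation (σ.comp ρ) (τ.comp ρ) (D ∘ₗ ρ.toLinearMap) := fun x y => by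
  simp only [LinearMap.comp_apply, AlgHom.toLinearMap_apply, AlgHom.comp_apply, map_mul, hD _ _]

theorem exists_of_tensorAlgebra {M : Type*} [AddCommGroup M] [Module R M]
    (σ τ : TensorAlgebra R M →ₐ[R] B) (δ : M →ₗ[R] B) :
    ∃ D, IsSkewDerivation σ τ D ∧ ∀ m, D (TensorAlgebra.ι R m) = δ m := by
  let T : TensorAlgebra R M →ₐ[R] Matrix (Fin 2) (Fin 2) B := TensorAlgebra.lift R
    { toFun m := !![σ (TensorAlgebra.ι R m), δ m; 0, τ (TensorAlgebra.ι R m)]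
      map_add' m m' := by simp
      map_smul' r m := by simp }
  have T_diag (t) : T t 0 0 = σ t ∧ T t 1 0 = 0 ∧ T t 1 1 = τ t := by
    induction t using TensorAlgebra.induction with
    | algebraMap r => simp [Matrix.algebraMap_matrix_apply]
    | ι m => simp [T]
    | mul x y hx hy => simp [Matrix.mul_apply, hx, hy]
    | add x y hx hy => simp [hx, hy]
  refine ⟨(Matrix.entryLinearMap R B 0 1) ∘ₗ T.toLinearMap, fun x y => ?_, fun m => ?_⟩
  · simp [Matrix.mul_apply, T_diag, add_comm]
  · simp [T]

end IsSkewDerivation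

end SkewDerivation

namespace GDSAlg

section Parity

variable {A : GDSAlg.{u}} {B : GDSAlg.{v}}

/-- The parity operator as an algebra endomorphism, along which `d` is a skew derivation. -/
def parityHom (A : GDSAlg.{u}) : A →ₐ[ℂ] A := AlgHom.ofLinearMap A.parity A.parity_one A.parity_mul

theorem parityHom_apply (x : A) : A.parityHom x = A.parity x := rfl

theorem isSkewDerivation_d (A : GDSAlg.{u}) : IsSkewDerivation A.parityHom (AlgHom.id ℂ A) A.d :=
  A.leibniz

theorem map_parity_of_map_mem (f : A →ₗ[ℂ] B) (hf : ∀ n, ∀ x ∈ A.gr n, f x ∈ B.gr n) (x : A) :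
    f (A.parity x) = B.parity (f x) := by
  induction x using hom_induction A.gr with
  | h n x hx => rw [parity_apply hx, parity_apply (hf n x hx), map_smul]
  | hadd x y hx hy => simp only [map_add, hx, hy]

theorem isSkewDerivation_comp_parityHom_iff {R : Type*} [Ring R] [Algebra ℂ R]
    {f g : A →ₐ[ℂ] R} {L : A →ₗ[ℂ] R} :
    IsSkewDerivation (f.comp A.parityHom) g L ↔
      ∀ n, ∀ x ∈ A.gr n, ∀ y, L (x * y) = L x * g y + (-1 : ℂ) ^ n • (f x * L y) := by
  constructor
  · intro hL n x hx y
    rw [hL x y, AlgHom.comp_apply, parityHom_apply, parity_apply hx, map_smul, smul_mul_assoc]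
  · intro hL x y
    induction x using hom_induction A.gr with
    | h n x hx =>
      rw [hL n x hx, AlgHom.comp_apply, parityHom_apply, parity_apply hx, map_smul, smul_mul_assoc]
    | hadd x x' hx hx' => simp only [add_mul, map_add, hx, hx']; abel

theorem st_one (A : GDSAlg.{u}) : A.st 1 = 1 := by
  have h := A.st_mul 0 0 _ (A.st_mem 0 1 A.one_mem) 1 A.one_mem
  simpa only [A.st_st, mul_one, mul_zero, pow_zero, one_smul, eq_comm] using h

end Parity

end GDSAlg

/-- The homomorphism `* ∘ f ∘ *`; a graded homomorphism `f` is hermitian when it equals its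
conjugate. -/
def DGHom.conj {A : GDSAlg.{u}} {B : GDSAlg.{v}} (f : DGHom A B)
    (hf : ∀ n, ∀ x ∈ A.gr n, f x ∈ B.gr n) : DGHom A B where
  toAlgHom := AlgHom.ofLinearMap (B.st.comp (f.toAlgHom.toLinearMap.comp A.st))
    (by simp [A.st_one, B.st_one]) <| by
      have mul_homogeneous {m n : ℕ} {x y : A} (hx : x ∈ A.gr m) (hy : y ∈ A.gr n) :
          B.st (f (A.st (x * y))) = B.st (f (A.st x)) * B.st (f (A.st y)) := by
        rw [A.st_mul m n x hx y hy, map_smul, map_mul, map_smulₛₗ,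
          B.st_mul n m _ (hf n _ (A.st_mem n y hy)) _ (hf m _ (A.st_mem m x hx)), smul_smul,
          map_pow, map_neg, map_one, mul_comm n m, ← mul_pow, neg_one_mul, neg_neg, one_pow,
          one_smul]
      intro x y
      change B.st (f (A.st (x * y))) = B.st (f (A.st x)) * B.st (f (A.st y))
      induction x using hom_induction A.gr with
      | hadd x x' hx hx' => simp only [add_mul, map_add, hx, hx']
      | h m x hx =>
        induction y using hom_induction A.gr with
        | hadd y y' hy hy' => simp only [mul_add, map_add, hy, hy']
        | h n y hy => exact mul_homogeneous hx hy
  map_d x := by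
    change B.st (f (A.st (A.d x))) = B.d (B.st (f (A.st x)))
    rw [A.st_d, f.map_d, B.st_d]

theorem DGHom.conj_apply {A : GDSAlg.{u}} {B : GDSAlg.{v}} (f : DGHom A B)
    (hf : ∀ n, ∀ x ∈ A.gr n, f x ∈ B.gr n) (x : A) : f.conj hf x = B.st (f (A.st x)) := rfl

namespace GDSAlg

section Parity

variable {A : GDSAlg.{u}} {B : GDSAlg.{v}}

theorem parity_pow_apply (j : ℕ) {n : ℕ} {x : A} (hx : x ∈ A.gr n) :
    (A.parity ^ j) x = (-1 : ℂ) ^ (j * n) • x := by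
  induction j with
  | zero => simp
  | succ j ih =>
    rw [pow_succ', Module.End.mul_apply, ih, map_smul, parity_apply hx, smul_smul, ← pow_add,
      add_mul, one_mul]

theorem map_parity_pow {L : A →ₗ[ℂ] B} {c : ℂ}
    (hL : ∀ x, L (A.parity x) = c • B.parity (L x)) (j : ℕ) (x : A) :
    L ((A.parity ^ j) x) = c ^ j • (B.parity ^ j) (L x) := by
  induction j with
  | zero => simp
  | succ j ih =>
    rw [pow_succ', Module.End.mul_apply, hL, ih, map_smul, smul_smul, pow_succ' c, pow_succ',
      Module.End.mul_apply]

theorem map_parity_pow_of_even {f : A →ₗ[ℂ] B} (hf : ∀ x, f (A.parity x) = B.parity (f x)) (j : ℕ)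
    (x : A) : f ((A.parity ^ j) x) = (B.parity ^ j) (f x) := by
  have hf' (x) : f (A.parity x) = (1 : ℂ) • B.parity (f x) := by rw [hf, one_smul]
  rw [map_parity_pow hf', one_pow, one_smul]

end Parity

section TensorMapLeft

variable {A : GDSAlg.{u}} {B : GDSAlg.{v}} (C : GDSAlg.{w})

theorem tensorMapLeft_tmul (f : A →ₗ[ℂ] B) (a : A) (c : C) :
    tensorMapLeft C f (a ᵍ⊗ₜ[ℂ] c) = f a ᵍ⊗ₜ[ℂ] c := by
  simp [tensorMapLeft]

theorem tensorMapLeft_of_rTensor (f : A →ₗ[ℂ] B) {M : Type*} [AddCommGroup M] [Module ℂ M]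
    (φ : M →ₗ[ℂ] A) (t : M ⊗[ℂ] C) :
    tensorMapLeft C f (GradedTensorProduct.of ℂ A.gr C.gr (φ.rTensor C t)) =
      GradedTensorProduct.of ℂ B.gr C.gr ((f ∘ₗ φ).rTensor C t) := by
  rw [LinearMap.rTensor_comp]
  rfl

theorem tensorMapLeft_sub (f g : A →ₗ[ℂ] B) (x : A.gr ᵍ⊗[ℂ] C.gr) :
    tensorMapLeft C (f - g) x = tensorMapLeft C f x - tensorMapLeft C g x := by
  simp only [tensorMapLeft, ← LinearMap.rTensor_def, LinearMap.rTensor_sub, LinearMap.comp_apply,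
    LinearMap.sub_apply, map_sub]

variable {C}

theorem tmul_mul_tmul_eq_parity_pow {j : ℕ} (a a' : A) {c : C} (hc : c ∈ C.gr j) (c' : C) :
    (a ᵍ⊗ₜ[ℂ] c * a' ᵍ⊗ₜ[ℂ] c' : A.gr ᵍ⊗[ℂ] C.gr) =
      (a * (A.parity ^ j) a') ᵍ⊗ₜ[ℂ] (c * c') := by
  induction a' using hom_induction A.gr with
  | h i a' ha' =>
    rw [tmul_mul_tmul a hc ha', parity_pow_apply j ha', mul_smul_comm, GradedTensorProduct.tmul,
      GradedTensorProduct.tmul, ← smul_tmul', map_smul]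
  | hadd x y hx hy =>
    simp only [GradedTensorProduct.tmul, add_tmul, mul_add, map_add] at hx hy ⊢
    rw [hx, hy]

theorem tensorMapLeft_mul_of_even {f : A →ₐ[ℂ] B}
    (hf : ∀ x, f (A.parity x) = B.parity (f x)) (x y : A.gr ᵍ⊗[ℂ] C.gr) :
    tensorMapLeft C f.toLinearMap (x * y) =
      tensorMapLeft C f.toLinearMap x * tensorMapLeft C f.toLinearMap y := by
  induction x using tensor_induction with
  | hadd x x' hx hx' => simp only [add_mul, map_add, hx, hx']
  | h _ j a _ c hc =>
    induction y using tensor_induction with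
    | hadd y y' hy hy' => simp only [mul_add, map_add, hy, hy']
    | h _ _ a' _ c' _ =>
      have hf_pow : f ((A.parity ^ j) a') = (B.parity ^ j) (f a') :=
        map_parity_pow_of_even (f := f.toLinearMap) hf j a'
      simp only [tmul_mul_tmul_eq_parity_pow _ _ hc, tensorMapLeft_tmul, AlgHom.toLinearMap_apply,
        map_mul, hf_pow]

theorem tensorMapLeft_mul_of_isSkewDerivation {f g : A →ₐ[ℂ] B} {L : A →ₗ[ℂ] B}
    (hg : ∀ x, g (A.parity x) = B.parity (g x)) (hL : IsSkewDerivation (f.comp A.parityHom) g L)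
    (L_odd : ∀ x, L (A.parity x) = -B.parity (L x)) {n : ℕ} {x : A.gr ᵍ⊗[ℂ] C.gr}
    (hx : x ∈ tensorGr A C n) (y : A.gr ᵍ⊗[ℂ] C.gr) :
    tensorMapLeft C L (x * y) = tensorMapLeft C L x * tensorMapLeft C g.toLinearMap y +
      (-1 : ℂ) ^ n • (tensorMapLeft C f.toLinearMap x * tensorMapLeft C L y) := by
  induction hx using Submodule.span_induction with
  | zero => simp
  | add x x' _ _ hx hx' => simp only [add_mul, map_add, smul_add, hx, hx']; abel
  | smul r x _ hx => simp only [smul_mul_assoc, map_smul, hx, smul_add, smul_comm r]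
  | mem x hx =>
    obtain ⟨i, j, rfl, a, ha, c, hc, rfl⟩ := hx
    induction y using tensor_induction with
    | hadd y y' hy hy' => simp only [mul_add, map_add, smul_add, hy, hy']; abel
    | h _ _ a' _ c' _ =>
      have hg_pow : g ((A.parity ^ j) a') = (B.parity ^ j) (g a') :=
        map_parity_pow_of_even (f := g.toLinearMap) hg j a'
      have hL_pow : L ((A.parity ^ j) a') = (-1 : ℂ) ^ j • (B.parity ^ j) (L a') :=
        map_parity_pow (fun x => by rw [L_odd, neg_one_smul]) j a'
      simp only [tmul_mul_tmul_eq_parity_pow _ _ hc, tensorMapLeft_tmul, AlgHom.toLinearMap_apply,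
        isSkewDerivation_comp_parityHom_iff.1 hL i a ha, hg_pow, hL_pow, GradedTensorProduct.tmul,
        add_tmul, mul_smul_comm, ← smul_tmul', map_add, map_smul, smul_smul, ← pow_add]

theorem tensorMapLeft_tensorD {f : A →ₗ[ℂ] B} (hf : ∀ x, f (A.parity x) = B.parity (f x))
    (map_d : ∀ x, f (A.d x) = B.d (f x)) (x : A.gr ᵍ⊗[ℂ] C.gr) :
    tensorMapLeft C f (tensorD A C x) = tensorD B C (tensorMapLeft C f x) := by
  induction x using tensor_induction with
  | hadd x y hx hy => simp only [map_add, hx, hy]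
  | h _ _ a _ c _ => simp only [tensorD_tmul, map_add, tensorMapLeft_tmul, map_d, hf]

theorem tensorMapLeft_tensorD_add_tensorD {L : A →ₗ[ℂ] B}
    (L_odd : ∀ x, L (A.parity x) = -B.parity (L x)) (x : A.gr ᵍ⊗[ℂ] C.gr) :
    tensorMapLeft C L (tensorD A C x) + tensorD B C (tensorMapLeft C L x) =
      tensorMapLeft C (L ∘ₗ A.d + B.d ∘ₗ L) x := by
  induction x using tensor_induction with
  | hadd x y hx hy => rw [map_add (tensorMapLeft C (_ + _)), ← hx, ← hy]; simp only [map_add]; abel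
  | h _ _ a _ c _ =>
    simp only [tensorD_tmul, map_add, tensorMapLeft_tmul, L_odd, LinearMap.add_apply,
      LinearMap.comp_apply, GradedTensorProduct.tmul, add_tmul, neg_tmul, map_neg]
    abel

end TensorMapLeft

end GDSAlg

section Generators

variable {A : GDSAlg.{u}} {B : GDSAlg.{v}} {C : GDSAlg.{w}} {S : Set A}

/-- The homomorphism `f ⊗ id` of graded tensor products induced by a parity preserving
homomorphism `f`. -/
def GDSAlg.tensorMapLeftHom (C : GDSAlg.{w}) (f : A →ₐ[ℂ] B)
    (hf : ∀ x, f (A.parity x) = B.parity (f x)) : A.gr ᵍ⊗[ℂ] C.gr →ₐ[ℂ] B.gr ᵍ⊗[ℂ] C.gr :=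
  AlgHom.ofLinearMap (GDSAlg.tensorMapLeft C f.toLinearMap)
    ((GDSAlg.tensorMapLeft_tmul C f.toLinearMap 1 1).trans
      (congrArg (fun b : B => b ᵍ⊗ₜ[ℂ] (1 : C)) (map_one f)))
    (GDSAlg.tensorMapLeft_mul_of_even hf)

/-- `f` is equivariant for the coactions `Φ` and `Ψ`. -/
def DGCoaction.Intertwines (Φ : DGCoaction A C) (Ψ : DGCoaction B C) (f : A →ₗ[ℂ] B) : Prop :=
  ∀ x, Ψ (f x) = GDSAlg.tensorMapLeft C f (Φ x)

theorem DGCoaction.Intertwines.map_mem_invariants {Φ : DGCoaction A C} {Ψ : DGCoaction B C}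
    {f : A →ₗ[ℂ] B} (hf : Φ.Intertwines Ψ f) {x : A} (hx : x ∈ Φ.invariants) :
    f x ∈ Ψ.invariants := by
  rw [DGCoaction.mem_invariants] at hx ⊢
  rw [hf, hx, GDSAlg.tensorMapLeft_tmul]

theorem DGSub.cohomologyMap_eq_of_homotopy {K : DGSub A} {K' : DGSub B} {f g : DGHom A B}
    (hf : ∀ x ∈ K, f x ∈ K') (hg : ∀ x ∈ K, g x ∈ K') (L : A →ₗ[ℂ] B)
    (hL : ∀ x, f x - g x = L (A.d x) + B.d (L x)) (hLK : ∀ x ∈ K, L x ∈ K') :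
    DGSub.cohomologyMap f hf = DGSub.cohomologyMap g hg := by
  ext y
  obtain ⟨x, rfl⟩ := Ideal.Quotient.mk_surjective y
  refine Ideal.Quotient.eq.2 ⟨L x, hLK x x.2.1, ?_⟩
  have sub_eq := hL x
  rw [x.2.2, map_zero, zero_add] at sub_eq
  exact sub_eq.symm

/-- `S` generates `A` as a differential algebra. -/
def GDSAlg.IsGeneratedBy (A : GDSAlg.{u}) (S : Set A) : Prop :=
  Algebra.adjoin ℂ (S ∪ A.d '' S) = ⊤

namespace GDSAlg.IsGeneratedBy

theorem algHom_ext {R : Type*} [Ring R] [Algebra ℂ R] (hS : A.IsGeneratedBy S) {f g : A →ₐ[ℂ] R}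
    (D : R → R) (hf : ∀ x, f (A.d x) = D (f x)) (hg : ∀ x, g (A.d x) = D (g x))
    (h : ∀ s ∈ S, f s = g s) : f = g := by
  refine AlgHom.ext_of_adjoin_eq_top hS ?_
  rintro _ (hs | ⟨s, hs, rfl⟩)
  · exact h _ hs
  · rw [hf, hg, h s hs]

theorem skewDerivation_ext {R : Type*} [Ring R] [Algebra ℂ R] (hS : A.IsGeneratedBy S)
    {σ τ : A →ₐ[ℂ] R} {D D' : A →ₗ[ℂ] R} (hD : IsSkewDerivation σ τ D)
    (hD' : IsSkewDerivation σ τ D') (h : ∀ s ∈ S, D s = D' s)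
    (h_d : ∀ s ∈ S, D (A.d s) = D' (A.d s)) : D = D' := by
  refine hD.ext_of_adjoin_eq_top hD' hS ?_
  rintro _ (hs | ⟨s, hs, rfl⟩)
  · exact h _ hs
  · exact h_d s hs

theorem map_d (hS : A.IsGeneratedBy S) {f : A →ₐ[ℂ] B}
    (hf : ∀ x, f (A.parity x) = B.parity (f x)) (h : ∀ s ∈ S, f (A.d s) = B.d (f s)) (x : A) :
    f (A.d x) = B.d (f x) := by
  have hf_parity : B.parityHom.comp f = f.comp A.parityHom := AlgHom.ext fun x => (hf x).symm
  have fd_skew : IsSkewDerivation (f.comp A.parityHom) f (f.toLinearMap ∘ₗ A.d) :=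
    A.isSkewDerivation_d.algHom_comp f
  have df_skew : IsSkewDerivation (f.comp A.parityHom) f (B.d ∘ₗ f.toLinearMap) :=
    hf_parity ▸ B.isSkewDerivation_d.comp_algHom f
  refine LinearMap.congr_fun (hS.skewDerivation_ext fd_skew df_skew h fun s hs => ?_) x
  simp only [LinearMap.comp_apply, AlgHom.toLinearMap_apply, h s hs, A.d_d, B.d_d, map_zero]

theorem map_st (hS : A.IsGeneratedBy S) (f : DGHom A B) (hf : ∀ n, ∀ x ∈ A.gr n, f x ∈ B.gr n)
    (h : ∀ s ∈ S, f (A.st s) = B.st (f s)) (x : A) : f (A.st x) = B.st (f x) := by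
  have conj_eq : (f.conj hf).toAlgHom = f.toAlgHom :=
    hS.algHom_ext B.d (f.conj hf).map_d f.map_d fun s hs => by rw [f.conj_apply, h s hs, B.st_st]
  rw [← DFunLike.congr_fun conj_eq x, f.conj_apply, B.st_st]

theorem intertwines (hS : A.IsGeneratedBy S) {f : DGHom A B}
    (hf : ∀ x, f (A.parity x) = B.parity (f x)) {Φ : DGCoaction A C} {Ψ : DGCoaction B C}
    (h : ∀ s ∈ S, Ψ (f s) = GDSAlg.tensorMapLeft C f.toAlgHom.toLinearMap (Φ s)) :
    Φ.Intertwines Ψ f.toAlgHom.toLinearMap := by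
  have hΨ (x : A) : Ψ (f (A.d x)) = GDSAlg.tensorD B C (Ψ (f x)) := by rw [f.map_d, Ψ.map_d]
  have hΦ (x : A) : GDSAlg.tensorMapLeftHom C f.toAlgHom hf (Φ (A.d x)) =
      GDSAlg.tensorD B C (GDSAlg.tensorMapLeftHom C f.toAlgHom hf (Φ x)) := by
    rw [Φ.map_d]
    exact GDSAlg.tensorMapLeft_tensorD hf f.map_d (Φ x)
  exact DFunLike.congr_fun (hS.algHom_ext (f := Ψ.toAlgHom.comp f.toAlgHom)
    (g := (GDSAlg.tensorMapLeftHom C f.toAlgHom hf).comp Φ.toAlgHom) _ hΨ hΦ h)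

end GDSAlg.IsGeneratedBy

/-- `L` is the homotopy from `f` to `g` determined by the generating set `S`: an odd derivation
along `f` and `g` that vanishes on `S`, with the value on `d S` that the homotopy formula
`f - g = L d + d L` forces. -/
structure IsDerivationHomotopy (S : Set A) (f g : DGHom A B) (L : A →ₗ[ℂ] B) : Prop where
  skew : IsSkewDerivation (f.toAlgHom.comp A.parityHom) g.toAlgHom L
  map_gen : ∀ s ∈ S, L s = 0
  map_d_gen : ∀ s ∈ S, L (A.d s) = f s - g s

theorem IsSkewDerivation.comp_d_add_d_comp {f g : DGHom A B} {L : A →ₗ[ℂ] B}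
    (hL : IsSkewDerivation (f.toAlgHom.comp A.parityHom) g.toAlgHom L)
    (hf : ∀ x, f (A.parity x) = B.parity (f x)) (L_odd : ∀ x, L (A.parity x) = -B.parity (L x)) :
    IsSkewDerivation f.toAlgHom g.toAlgHom (L ∘ₗ A.d + B.d ∘ₗ L) := by
  have hL' (x y : A) : L (x * y) = L x * g y + f (A.parity x) * L y := hL x y
  intro x y
  have parity_d_cancel : f (A.parity (A.d x)) + B.d (f (A.parity x)) = 0 := by
    rw [← f.map_d, A.d_parity, map_neg, add_neg_cancel]
  calc (L ∘ₗ A.d + B.d ∘ₗ L) (x * y)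
    _ = L (A.d x) * g y + f (A.parity (A.d x)) * L y
        + (L (A.parity x) * g (A.d y) + f x * L (A.d y))
        + (B.d (L x) * g y + B.parity (L x) * B.d (g y)
          + (B.d (f (A.parity x)) * L y + f x * B.d (L y))) := by
      simp only [LinearMap.add_apply, LinearMap.comp_apply, A.leibniz, hL', map_add, B.leibniz,
        A.parity_parity, hf, B.parity_parity]
    _ = (L (A.d x) + B.d (L x)) * g y + (f (A.parity (A.d x)) + B.d (f (A.parity x))) * L y
        + f x * (L (A.d y) + B.d (L y)) := by
      rw [L_odd, g.map_d]
      noncomm_ring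
    _ = (L ∘ₗ A.d + B.d ∘ₗ L) x * g y + f x * (L ∘ₗ A.d + B.d ∘ₗ L) y := by
      rw [parity_d_cancel, zero_mul, add_zero]
      rfl

namespace IsDerivationHomotopy

variable {f g : DGHom A B} {L L' : A →ₗ[ℂ] B}

theorem unique (hS : A.IsGeneratedBy S) (hL : IsDerivationHomotopy S f g L)
    (hL' : IsDerivationHomotopy S f g L') : L = L' :=
  hS.skewDerivation_ext hL.skew hL'.skew
    (fun s hs => by rw [hL.map_gen s hs, hL'.map_gen s hs])
    (fun s hs => by rw [hL.map_d_gen s hs, hL'.map_d_gen s hs])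

theorem map_parity (hS : A.IsGeneratedBy S) (S_homogeneous : ∀ s ∈ S, ∃ n, s ∈ A.gr n)
    (hf : ∀ x, f (A.parity x) = B.parity (f x)) (hg : ∀ x, g (A.parity x) = B.parity (g x))
    (hL : IsDerivationHomotopy S f g L) (x : A) : L (A.parity x) = -B.parity (L x) := by
  have hf_parity : B.parityHom.comp f.toAlgHom = f.toAlgHom.comp A.parityHom :=
    AlgHom.ext fun x => (hf x).symm
  have hg_parity : B.parityHom.comp g.toAlgHom = g.toAlgHom.comp A.parityHom :=
    AlgHom.ext fun x => (hg x).symm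
  have comp_parity_skew := hL.skew.comp_algHom A.parityHom
  have neg_parity_skew := (hL.skew.algHom_comp B.parityHom).neg
  rw [← AlgHom.comp_assoc, hf_parity, hg_parity] at neg_parity_skew
  refine LinearMap.congr_fun (hS.skewDerivation_ext comp_parity_skew neg_parity_skew ?_ ?_) x
  · intro s hs
    obtain ⟨n, hn⟩ := S_homogeneous s hs
    change L (A.parity s) = -B.parity (L s)
    rw [GDSAlg.parity_apply hn, map_smul, hL.map_gen s hs, smul_zero, map_zero, neg_zero]
  · intro s hs
    obtain ⟨n, hn⟩ := S_homogeneous s hs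
    change L (A.parity (A.d s)) = -B.parity (L (A.d s))
    rw [GDSAlg.parity_apply (A.d_mem n s hn), map_smul, hL.map_d_gen s hs, map_sub, ← hf, ← hg,
      GDSAlg.parity_apply hn, map_smul, map_smul, ← smul_sub, pow_succ, mul_neg_one, neg_smul]

theorem sub_eq (hS : A.IsGeneratedBy S) (hf : ∀ x, f (A.parity x) = B.parity (f x))
    (L_odd : ∀ x, L (A.parity x) = -B.parity (L x)) (hL : IsDerivationHomotopy S f g L) :
    f.toAlgHom.toLinearMap - g.toAlgHom.toLinearMap = L ∘ₗ A.d + B.d ∘ₗ L := by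
  refine hS.skewDerivation_ext (IsSkewDerivation.sub_algHom _ _)
    (hL.skew.comp_d_add_d_comp hf L_odd) (fun s hs => ?_) (fun s hs => ?_)
  · simp [hL.map_gen s hs, hL.map_d_gen s hs]
  · simp [hL.map_d_gen s hs, A.d_d, f.map_d, g.map_d]

theorem intertwines (hS : A.IsGeneratedBy S) (hf : ∀ x, f (A.parity x) = B.parity (f x))
    (hg : ∀ x, g (A.parity x) = B.parity (g x)) (L_odd : ∀ x, L (A.parity x) = -B.parity (L x))
    (hL : IsDerivationHomotopy S f g L) {Φ : DGCoaction A C} {Ψ : DGCoaction B C}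
    (f_equivariant : Φ.Intertwines Ψ f.toAlgHom.toLinearMap)
    (g_equivariant : Φ.Intertwines Ψ g.toAlgHom.toLinearMap)
    (h : ∀ s ∈ S, GDSAlg.tensorMapLeft C L (Φ s) = 0) : Φ.Intertwines Ψ L := by
  have left_skew := hL.skew.algHom_comp Ψ.toAlgHom
  have right_skew : IsSkewDerivation ((Ψ.toAlgHom.comp f.toAlgHom).comp A.parityHom)
      (Ψ.toAlgHom.comp g.toAlgHom) (GDSAlg.tensorMapLeft C L ∘ₗ Φ.toAlgHom.toLinearMap) := by
    refine GDSAlg.isSkewDerivation_comp_parityHom_iff.2 fun n x hx y => ?_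
    simp only [LinearMap.comp_apply, AlgHom.toLinearMap_apply, map_mul,
      GDSAlg.tensorMapLeft_mul_of_isSkewDerivation hg hL.skew L_odd (Φ.map_mem n x hx)]
    rw [← f_equivariant x, ← g_equivariant y]
    rfl
  have value_on_d (s) (hs : s ∈ S) : Ψ (L (A.d s)) = GDSAlg.tensorMapLeft C L (Φ (A.d s)) := by
    have tensor_homotopy := GDSAlg.tensorMapLeft_tensorD_add_tensorD L_odd (Φ s)
    rw [h s hs, map_zero, add_zero, ← hL.sub_eq hS hf L_odd, GDSAlg.tensorMapLeft_sub,
      ← f_equivariant, ← g_equivariant] at tensor_homotopy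
    rw [Φ.map_d, tensor_homotopy, hL.map_d_gen s hs, map_sub]
    rfl
  have value_on_gen (s) (hs : s ∈ S) : Ψ (L s) = GDSAlg.tensorMapLeft C L (Φ s) := by
    rw [hL.map_gen s hs, h s hs, map_zero]
  exact LinearMap.congr_fun
    (hS.skewDerivation_ext left_skew right_skew value_on_gen value_on_d)

end IsDerivationHomotopy

end Generators

namespace Free

variable {V : Type u} [AddCommGroup V] [Module ℂ V] {s : V →ₛₗ[starRingEnd ℂ] V}
  {hs : ∀ v, s (s v) = v} {k : ℕ} {B : GDSAlg.{v}}

variable (s hs k) in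
/-- The inclusion of the generating space `V` into the free graded-differential *-algebra. -/
def incl : V →ₗ[ℂ] free V s hs k := TensorAlgebra.ι ℂ ∘ₗ LinearMap.inl ℂ V V

theorem incl_mem (v : V) : incl s hs k v ∈ (free V s hs k).gr k := gen_mem k (Sum.inl v)

theorem d_incl (v : V) : (free V s hs k).d (incl s hs k v) = gen (Sum.inr v) := d_inl k v

theorem st_incl (v : V) : (free V s hs k).st (incl s hs k v) = incl s hs k (s v) := by
  refine (st_apply s (gen_mem k (Sum.inl v))).trans ?_
  rw [rev_gen, smul_smul, sgn_mul_self, one_smul]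
  rfl

theorem isGeneratedBy_range_incl : (free V s hs k).IsGeneratedBy (Set.range (incl s hs k)) := by
  have adjoin_ι : Algebra.adjoin ℂ (Set.range (TensorAlgebra.ι ℂ : V × V →ₗ[ℂ] _)) = ⊤ :=
    TensorAlgebra.adjoin_range_ι
  refine top_unique (adjoin_ι.symm.trans_le (Algebra.adjoin_le ?_))
  rintro _ ⟨⟨v, v'⟩, rfl⟩
  rw [ι_eq]
  exact add_mem (M := free V s hs k) (Algebra.subset_adjoin (A := free V s hs k) (Or.inl ⟨v, rfl⟩))
    (Algebra.subset_adjoin (A := free V s hs k) (Or.inr ⟨_, ⟨v', rfl⟩, d_incl v'⟩))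

theorem map_mem_of_map_incl_mem (f : free V s hs k →ₐ[ℂ] B)
    (h : ∀ v, f (incl s hs k v) ∈ B.gr k)
    (h_d : ∀ v, f ((free V s hs k).d (incl s hs k v)) = B.d (f (incl s hs k v)))
    (n : ℕ) (x : free V s hs k) (hx : x ∈ (free V s hs k).gr n) : f x ∈ B.gr n := by
  have gen_mem (a : V ⊕ V) : f (gen a : free V s hs k) ∈ B.gr (wt k a) := by
    rcases a with v | v
    · exact h v
    · rw [← d_incl, h_d]
      exact B.d_mem k _ (h v)
  induction hx using Submodule.span_induction with
  | zero => rw [map_zero]; exact zero_mem _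
  | add x y _ _ hx hy => rw [map_add]; exact add_mem hx hy
  | smul c x _ hx => rw [map_smul]; exact Submodule.smul_mem _ c hx
  | mem x hx =>
    obtain ⟨l, rfl, rfl⟩ := hx
    have map_word : f ((l.map gen).prod : free V s hs k) = (l.map fun a => f (gen a)).prod :=
      (map_list_prod f _).trans (congrArg List.prod List.map_map)
    rw [map_word]
    exact SetLike.list_prod_map_mem_graded l _ _ fun a _ => gen_mem a

theorem map_parity_of_map_incl_mem (f : DGHom (free V s hs k) B)
    (h : ∀ v, f (incl s hs k v) ∈ B.gr k) (x : free V s hs k) :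
    f ((free V s hs k).parity x) = B.parity (f x) :=
  GDSAlg.map_parity_of_map_mem f.toAlgHom.toLinearMap
    (map_mem_of_map_incl_mem f.toAlgHom h fun _ => f.map_d _) x

theorem exists_dgHom_incl_eq (φ : V →ₗ[ℂ] B) (hφ : ∀ v, φ v ∈ B.gr k) :
    ∃ f : DGHom (free V s hs k) B, ∀ v, f (incl s hs k v) = φ v := by
  let f : free V s hs k →ₐ[ℂ] B := TensorAlgebra.lift ℂ (φ.coprod (B.d ∘ₗ φ))
  have f_incl (v : V) : f (incl s hs k v) = φ v :=
    (TensorAlgebra.lift_ι_apply _ _).trans (by simp)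
  have f_d_incl (v : V) : f ((free V s hs k).d (incl s hs k v)) = B.d (f (incl s hs k v)) := by
    rw [f_incl, d_incl]
    exact (TensorAlgebra.lift_ι_apply _ _).trans (by simp)
  have f_parity := GDSAlg.map_parity_of_map_mem f.toLinearMap
    (map_mem_of_map_incl_mem f (fun v => (f_incl v).symm ▸ hφ v) f_d_incl)
  exact ⟨⟨f, isGeneratedBy_range_incl.map_d f_parity (Set.forall_mem_range.2 f_d_incl)⟩, f_incl⟩

theorem dgHom_ext {f g : DGHom (free V s hs k) B}
    (h : ∀ v, f (incl s hs k v) = g (incl s hs k v)) : f = g := by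
  have toAlgHom_eq : f.toAlgHom = g.toAlgHom :=
    isGeneratedBy_range_incl.algHom_ext B.d f.map_d g.map_d (Set.forall_mem_range.2 h)
  cases f
  cases g
  simpa using toAlgHom_eq

theorem exists_isDerivationHomotopy (f g : DGHom (free V s hs k) B) :
    ∃ L, IsDerivationHomotopy (Set.range (incl s hs k)) f g L := by
  obtain ⟨L, hL, L_ι⟩ := IsSkewDerivation.exists_of_tensorAlgebra
    (f.toAlgHom.comp (free V s hs k).parityHom) g.toAlgHom
    ((f.toAlgHom.toLinearMap - g.toAlgHom.toLinearMap) ∘ₗ incl s hs k ∘ₗ LinearMap.snd ℂ V V)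
  refine ⟨L, hL, Set.forall_mem_range.2 fun v => ?_, Set.forall_mem_range.2 fun v => ?_⟩
  · exact (L_ι (v, 0)).trans (by simp)
  · rw [d_incl]
    exact L_ι (0, v)

end Free

section General

variable {V : Type*} [AddCommGroup V] [Module ℂ V] {A : GDSAlg.{u}} {B : GDSAlg.{v}}
  {C : GDSAlg.{w}}

/-- The affine transformation law `Φ (φ v) = (φ ⊗ id) ϖ(v) + 1 ⊗ κ v` of a connection form `φ`. -/
def DGCoaction.TransformsAffinely (Φ : DGCoaction A C) (ϖ : V →ₗ[ℂ] V ⊗[ℂ] C) (κ : V →ₗ[ℂ] C)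
    (φ : V →ₗ[ℂ] A) : Prop :=
  ∀ v, Φ (φ v) = GradedTensorProduct.of ℂ A.gr C.gr (φ.rTensor C (ϖ v)) + 1 ᵍ⊗ₜ[ℂ] κ v

variable {Φ : DGCoaction A C} {Ψ : DGCoaction B C} {ϖ : V →ₗ[ℂ] V ⊗[ℂ] C} {κ : V →ₗ[ℂ] C}
  {φ : V →ₗ[ℂ] A}

theorem DGCoaction.TransformsAffinely.tensorMapLeft_apply (hφ : Φ.TransformsAffinely ϖ κ φ)
    (F : A →ₗ[ℂ] B) (v : V) : GDSAlg.tensorMapLeft C F (Φ (φ v)) =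
      GradedTensorProduct.of ℂ B.gr C.gr ((F ∘ₗ φ).rTensor C (ϖ v)) + F 1 ᵍ⊗ₜ[ℂ] κ v := by
  rw [hφ, map_add, GDSAlg.tensorMapLeft_of_rTensor, GDSAlg.tensorMapLeft_tmul]

theorem DGCoaction.TransformsAffinely.intertwines (hφ : Φ.TransformsAffinely ϖ κ φ)
    (hA : A.IsGeneratedBy (Set.range φ)) {f : DGHom A B}
    (hf : ∀ x, f (A.parity x) = B.parity (f x))
    (h : Ψ.TransformsAffinely ϖ κ (f.toAlgHom.toLinearMap ∘ₗ φ)) :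
    Φ.Intertwines Ψ f.toAlgHom.toLinearMap :=
  hA.intertwines hf <| Set.forall_mem_range.2 fun v => by
    rw [hφ.tensorMapLeft_apply, AlgHom.toLinearMap_apply, map_one]
    exact h v

theorem DGCoaction.TransformsAffinely.tensorMapLeft_eq_zero (hφ : Φ.TransformsAffinely ϖ κ φ)
    {f g : DGHom A B} {L : A →ₗ[ℂ] B} (hL : IsDerivationHomotopy (Set.range φ) f g L) (v : V) :
    GDSAlg.tensorMapLeft C L (Φ (φ v)) = 0 := by
  have L_comp : L ∘ₗ φ = 0 := LinearMap.ext fun v => hL.map_gen _ ⟨v, rfl⟩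
  rw [hφ.tensorMapLeft_apply, L_comp, hL.skew.map_one]
  simp [GradedTensorProduct.tmul]

theorem DGCoaction.TransformsAffinely.exists_isDerivationHomotopy {s : V →ₛₗ[starRingEnd ℂ] V}
    {hs : ∀ v, s (s v) = v} {k : ℕ} {Φ : DGCoaction (free V s hs k) C}
    (hΦ : Φ.TransformsAffinely ϖ κ (Free.incl s hs k)) {f g : DGHom (free V s hs k) B}
    (f_mem : ∀ v, f (Free.incl s hs k v) ∈ B.gr k) (g_mem : ∀ v, g (Free.incl s hs k v) ∈ B.gr k)
    (hf : Ψ.TransformsAffinely ϖ κ (f.toAlgHom.toLinearMap ∘ₗ Free.incl s hs k))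
    (hg : Ψ.TransformsAffinely ϖ κ (g.toAlgHom.toLinearMap ∘ₗ Free.incl s hs k)) :
    ∃ L, IsDerivationHomotopy (Set.range (Free.incl s hs k)) f g L ∧
      (∀ x, f x - g x = L ((free V s hs k).d x) + B.d (L x)) ∧ Φ.Intertwines Ψ L := by
  have generated := Free.isGeneratedBy_range_incl (s := s) (hs := hs) (k := k)
  have f_parity := Free.map_parity_of_map_incl_mem f f_mem
  have g_parity := Free.map_parity_of_map_incl_mem g g_mem
  obtain ⟨L, hL⟩ := Free.exists_isDerivationHomotopy f g
  have L_odd := hL.map_parity generated (Set.forall_mem_range.2 fun v => ⟨k, Free.incl_mem v⟩)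
    f_parity g_parity
  exact ⟨L, hL, LinearMap.congr_fun (hL.sub_eq generated f_parity L_odd),
    hL.intertwines generated f_parity g_parity L_odd (hΦ.intertwines generated f_parity hf)
      (hΦ.intertwines generated g_parity hg)
      (Set.forall_mem_range.2 (hΦ.tensorMapLeft_eq_zero hL))⟩

end General

section Bundle

variable {𝒜 : Type u} [Ring 𝒜] [StarRing 𝒜] [HopfAlgebra ℂ 𝒜] [StarModule ℂ 𝒜]
  {Γ : BicovariantCalculus 𝒜} (C : HigherOrderCalculus Γ)

/-- The adjoint coaction `ϖ` of `Γ_inv`, with values in the calculus on `G`. -/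
def formCoaction : Γ.inv →ₗ[ℂ] Γ.inv ⊗[ℂ] C.alg := C.incl.toLinearMap.lTensor Γ.inv ∘ₗ Γ.adj

variable [CompactMatrixQuantumGroup 𝒜]

theorem adjTilde_transformsAffinely :
    (adjTilde C).TransformsAffinely (formCoaction C) (C.inclΓ ∘ₗ Γ.inv.subtype) (omegaIncl Γ) := by
  intro ϑ
  rw [formCoaction, LinearMap.comp_apply, ← LinearMap.comp_apply, LinearMap.rTensor_comp_lTensor]
  exact adjTildeHom_inl C ϑ

variable {C}
  {𝒱 : Type v} [Ring 𝒱] [StarRing 𝒱] [Algebra ℂ 𝒱] [StarModule ℂ 𝒱]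
  {ℬ : Type w} [Ring ℬ] [StarRing ℬ] [Algebra ℂ ℬ] [StarModule ℂ ℬ]
  {P : QuantumPrincipalBundle 𝒜 𝒱 ℬ} {Q : BundleCalculus P C}

theorem Connection.transformsAffinely (ω : Connection Q) :
    Q.Fhat.TransformsAffinely (formCoaction C) (C.inclΓ ∘ₗ Γ.inv.subtype) ω.form := by
  intro ϑ
  rw [formCoaction, LinearMap.comp_apply, ← LinearMap.comp_apply, LinearMap.rTensor_comp_lTensor]
  exact ω.Fhat_form ϑ

theorem Connection.ExtendsTo.map_mem {ω : Connection Q} {f : DGHom (Omega Γ) Q.Ω}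
    (hf : ω.ExtendsTo f) (ϑ : Γ.inv) : f (omegaIncl Γ ϑ) ∈ Q.Ω.gr 1 :=
  (hf ϑ).symm ▸ ω.form_mem ϑ

theorem Connection.ExtendsTo.transformsAffinely {ω : Connection Q} {f : DGHom (Omega Γ) Q.Ω}
    (hf : ω.ExtendsTo f) : Q.Fhat.TransformsAffinely (formCoaction C) (C.inclΓ ∘ₗ Γ.inv.subtype)
      (f.toAlgHom.toLinearMap ∘ₗ omegaIncl Γ) := by
  have f_comp : f.toAlgHom.toLinearMap ∘ₗ omegaIncl Γ = ω.form := LinearMap.ext hf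
  exact f_comp ▸ ω.transformsAffinely

theorem Connection.isHomotopy_iff {ω τ : Connection Q} {f g : DGHom (Omega Γ) Q.Ω}
    (hf : ω.ExtendsTo f) (hg : τ.ExtendsTo g) {L : Omega Γ →ₗ[ℂ] Q.Ω} :
    IsHomotopy ω τ f g L ↔ IsDerivationHomotopy (Set.range (omegaIncl Γ)) f g L := by
  constructor
  · intro hL
    exact ⟨GDSAlg.isSkewDerivation_comp_parityHom_iff.2 hL.map_mul,
      Set.forall_mem_range.2 hL.map_incl,
      Set.forall_mem_range.2 fun ϑ => by rw [hL.map_d_incl, hf, hg]⟩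
  · intro hL
    exact ⟨hL.skew.map_one, Set.forall_mem_range.1 hL.map_gen,
      fun ϑ => by rw [hL.map_d_gen _ ⟨ϑ, rfl⟩, hf, hg],
      GDSAlg.isSkewDerivation_comp_parityHom_iff.1 hL.skew⟩

end Bundle

end QPB

end

theorem mainTheorem2_general {V : Type u} [AddCommGroup V] [Module ℂ V]
    {s : V →ₛₗ[starRingEnd ℂ] V} {hs : ∀ v, s (s v) = v} {k : ℕ} {B : GDSAlg.{v}} {C : GDSAlg.{w}}
    {ϖ : V →ₗ[ℂ] V ⊗[ℂ] C} {κ : V →ₗ[ℂ] C} {Φ : DGCoaction (free V s hs k) C}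
    {Ψ : DGCoaction B C} (hΦ : Φ.TransformsAffinely ϖ κ (Free.incl s hs k)) :
    (∀ φ : V →ₗ[ℂ] B, (∀ v, φ v ∈ B.gr k) → (∀ v, φ (s v) = B.st (φ v)) →
      Ψ.TransformsAffinely ϖ κ φ → ∃ f : DGHom (free V s hs k) B,
        ((∀ v, f (Free.incl s hs k v) = φ v) ∧
          ∀ f' : DGHom (free V s hs k) B, (∀ v, f' (Free.incl s hs k v) = φ v) → f' = f) ∧
        (∀ n, ∀ x ∈ (free V s hs k).gr n, f x ∈ B.gr n) ∧
        (∀ x, f ((free V s hs k).st x) = B.st (f x)) ∧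
        Φ.Intertwines Ψ f.toAlgHom.toLinearMap ∧
        (∀ x ∈ Φ.invariants, f x ∈ Ψ.invariants)) ∧
    (∀ f g : DGHom (free V s hs k) B,
      (∀ v, f (Free.incl s hs k v) ∈ B.gr k) → (∀ v, g (Free.incl s hs k v) ∈ B.gr k) →
      Ψ.TransformsAffinely ϖ κ (f.toAlgHom.toLinearMap ∘ₗ Free.incl s hs k) →
      Ψ.TransformsAffinely ϖ κ (g.toAlgHom.toLinearMap ∘ₗ Free.incl s hs k) →
      (∀ (hf : ∀ x ∈ Φ.invariants, f x ∈ Ψ.invariants)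
        (hg : ∀ x ∈ Φ.invariants, g x ∈ Ψ.invariants),
        DGSub.cohomologyMap f hf = DGSub.cohomologyMap g hg) ∧
      ∃ L : free V s hs k →ₗ[ℂ] B,
        (IsDerivationHomotopy (Set.range (Free.incl s hs k)) f g L ∧
          ∀ L', IsDerivationHomotopy (Set.range (Free.incl s hs k)) f g L' → L' = L) ∧
        (∀ x, f x - g x = L ((free V s hs k).d x) + B.d (L x)) ∧
        Φ.Intertwines Ψ L ∧
        (∀ x ∈ Φ.invariants, L x ∈ Ψ.invariants)) := by
  have generated := Free.isGeneratedBy_range_incl (s := s) (hs := hs) (k := k)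
  constructor
  · intro φ φ_mem φ_st hφ
    obtain ⟨f, f_incl⟩ := Free.exists_dgHom_incl_eq (s := s) (hs := hs) φ φ_mem
    have f_comp : f.toAlgHom.toLinearMap ∘ₗ Free.incl s hs k = φ := LinearMap.ext f_incl
    have f_mem := Free.map_mem_of_map_incl_mem f.toAlgHom
      (fun v => (f_incl v).symm ▸ φ_mem v) (fun v => f.map_d _)
    have f_equivariant : Φ.Intertwines Ψ f.toAlgHom.toLinearMap :=
      hΦ.intertwines generated (GDSAlg.map_parity_of_map_mem f.toAlgHom.toLinearMap f_mem)
        (f_comp.symm ▸ hφ)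
    refine ⟨f, ⟨f_incl, fun f' hf' => Free.dgHom_ext fun v => (hf' v).trans (f_incl v).symm⟩, f_mem,
      generated.map_st f f_mem (Set.forall_mem_range.2 fun v => ?_), f_equivariant,
      fun x => f_equivariant.map_mem_invariants⟩
    rw [Free.st_incl, f_incl, f_incl, φ_st]
  · intro f g f_mem g_mem hf hg
    obtain ⟨L, hL, homotopy, L_equivariant⟩ := hΦ.exists_isDerivationHomotopy f_mem g_mem hf hg
    have L_invariants (x) (hx : x ∈ Φ.invariants) : L x ∈ Ψ.invariants :=
      L_equivariant.map_mem_invariants hx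
    exact ⟨fun hfK hgK => DGSub.cohomologyMap_eq_of_homotopy hfK hgK L homotopy L_invariants,
      L, ⟨hL, fun L' hL' => hL'.unique generated hL⟩, homotopy, L_equivariant, L_invariants⟩

theorem mainTheorem2
    {𝒜 : Type u} [Ring 𝒜] [StarRing 𝒜] [HopfAlgebra ℂ 𝒜] [StarModule ℂ 𝒜]
    [CompactMatrixQuantumGroup 𝒜]
    {𝒱 : Type v} [Ring 𝒱] [StarRing 𝒱] [Algebra ℂ 𝒱] [StarModule ℂ 𝒱]
    {ℬ : Type w} [Ring ℬ] [StarRing ℬ] [Algebra ℂ ℬ] [StarModule ℂ ℬ]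
    (Γ : BicovariantCalculus 𝒜) (C : HigherOrderCalculus Γ)
    (P : QuantumPrincipalBundle 𝒜 𝒱 ℬ) (Q : BundleCalculus P C) :
    (∀ ω : Connection Q, ∃ f : DGHom (Omega Γ) Q.Ω,
      (ω.ExtendsTo f ∧ ∀ f' : DGHom (Omega Γ) Q.Ω, ω.ExtendsTo f' → f' = f) ∧
      (∀ n, ∀ x ∈ (Omega Γ).gr n, f x ∈ Q.Ω.gr n) ∧
      (∀ x, f ((Omega Γ).st x) = Q.Ω.st (f x)) ∧
      (∀ x, Q.Fhat (f x) =
        GDSAlg.tensorMapLeft C.alg f.toAlgHom.toLinearMap (adjTilde C x)) ∧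
      (∀ x ∈ daleth C, f x ∈ Q.baseForms)) ∧
    (∀ (ω τ : Connection Q) (f g : DGHom (Omega Γ) Q.Ω), ω.ExtendsTo f → τ.ExtendsTo g →
      (∀ (hf : ∀ x ∈ daleth C, f x ∈ Q.baseForms) (hg : ∀ x ∈ daleth C, g x ∈ Q.baseForms),
        DGSub.cohomologyMap f hf = DGSub.cohomologyMap g hg) ∧
      (∃ L : Omega Γ →ₗ[ℂ] Q.Ω,
        (IsHomotopy ω τ f g L ∧ ∀ L', IsHomotopy ω τ f g L' → L' = L) ∧
        (∀ x, f x - g x = L ((Omega Γ).d x) + Q.Ω.d (L x)) ∧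
        (∀ x, Q.Fhat (L x) = GDSAlg.tensorMapLeft C.alg L (adjTilde C x)) ∧
        (∀ x ∈ daleth C, L x ∈ Q.baseForms))) := by
  have general := mainTheorem2_general (Ψ := Q.Fhat) (adjTilde_transformsAffinely C)
  refine ⟨fun ω => general.1 ω.form ω.form_mem ω.form_st ω.transformsAffinely,
    fun ω τ f g hf hg => ?_⟩
  simp only [Connection.isHomotopy_iff hf hg]
  exact general.2 f g hf.map_mem hg.map_mem hf.transformsAffinely hg.transformsAffinely
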